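/- Let $d\ge 1$, $s\in(0,1)$, and let $\Omega=\{x\in\mathbb{R}^d : |x-a|<r\}$ be a ball with centre $a\in\mathbb{R}^d$ and radius $r>0$. For $x\in\Omega$ and $v\in\mathbb{R}^d$ let $\eta(x,v)\in\bar\Omega$ be the position at time $1$ of the trajectory that starts at $x$ with velocity $v$, moves in straight lines at constant speed inside $\Omega$, and whose velocity is specularly reflected, $v\mapsto v-2(n(y)\cdot v)\,n(y)$ with $n(y)=(y-a)/|y-a|$, each time it hits a point $y\in\partial\Omega$. Put $$c_{d,s}=\Big(\int_{\mathbb{R}^d}\frac{1-\cos\zeta_1}{|\zeta|^{d+2s}}\,d\zeta\Big)^{-1},\qquad (-\Delta)^s_{SR}\psi(x)=c_{d,s}\lim_{\varepsilon\to0^+}\int_{|w|>\varepsilon}\frac{\psi(x)-\psi(\eta(x,w))}{|w|^{d+2s}}\,dw .$$ Then for all $\varphi,\psi\in C^2(\bar\Omega)$: for every $x\in\Omega$ the truncated integrals converge absolutely and the limit defining $(-\Delta)^s_{SR}\psi(x)$ exists; the function $\varphi\,(-\Delta)^s_{SR}\psi$ is integrable on $\Omega$, the integrand on the right-hand side below is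 integrable on $\Omega\times\mathbb{R}^d$, and $$\int_\Omega \varphi(x)\,(-\Delta)^s_{SR}\psi(x)\,dx=\frac{c_{d,s}}{2}\iint_{\Omega\times\mathbb{R}^d}\big(\varphi(x)-\varphi(\eta(x,v))\big)\big(\psi(x)-\psi(\eta(x,v))\big)\frac{dv\,dx}{|v|^{d+2s}} .$$ Consequently the specular diffusion operator is symmetric: $$\int_\Omega \varphi(x)\,(-\Delta)^s_{SR}\psi(x)\,dx=\int_\Omega \psi(x)\,(-\Delta)^s_{SR}\varphi(x)\,dx .$$ -/

import Mathlib

open MeasureTheory Filter Topology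

noncomputable section

namespace SpecularBall

variable {d : ℕ}

/-- The space `ℝ^d` with its Euclidean norm. -/
abbrev E (d : ℕ) : Type := EuclideanSpace ℝ (Fin d)

/-- The constant `c_{d,s} = (∫_{ℝ^d} (1 - cos ζ₁) / |ζ|^{d+2s} dζ)⁻¹`. -/
def fracConst (d : ℕ) [NeZero d] (s : ℝ) : ℝ :=
  (∫ ζ : E d, (1 - Real.cos (ζ 0)) / ‖ζ‖ ^ ((d : ℝ) + 2 * s))⁻¹

/-- The outward unit normal, at the boundary point `y`, of a ball centred at `a`. -/
def normal (a y : E d) : E d := ‖y - a‖⁻¹ • (y - a)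

/-- The specular reflection `R_y v = v - 2 (n(y) · v) n(y)` at the boundary point `y` of a ball
centred at `a`. -/
def reflect (a y v : E d) : E d := v - (2 * inner ℝ (normal a y) v) • normal a y

/-- The first positive time at which the line `t ↦ p + t w` meets the sphere with centre `a` and
radius `r`. -/
def hitTime (a : E d) (r : ℝ) (p w : E d) : ℝ :=
  sInf {t : ℝ | 0 < t ∧ p + t • w ∈ Metric.sphere a r}

/-- Move from `p` with velocity `w` to the boundary of the ball, and reflect the velocity there. -/
def step (a : E d) (r : ℝ) (q : E d × E d) : E d × E d :=
  let y := q.1 + hitTime a r q.1 q.2 • q.2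
  (y, reflect a y q.2)

/-- Position and velocity just after the `k`-th reflection (for `k = 0`: the initial data) of the
specularly reflected trajectory in the ball that starts at `x` with velocity `v`. -/
def state (a : E d) (r : ℝ) (x v : E d) (k : ℕ) : E d × E d := (step a r)^[k] (x, v)

/-- The time `τ_k` of the `k`-th reflection, with `τ_0 = 0`. -/
def reflTime (a : E d) (r : ℝ) (x v : E d) (k : ℕ) : ℝ :=
  ∑ j ∈ Finset.range k, hitTime a r (state a r x v j).1 (state a r x v j).2

/-- The number `M` of reflections before time `1`: the first index `k` with `1 ≤ τ_{k+1}`.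
If `v = 0` there is no reflection, the set is empty and `M = 0`. -/
def numRefl (a : E d) (r : ℝ) (x v : E d) : ℕ := sInf {k : ℕ | 1 ≤ reflTime a r x v (k + 1)}

/-- The end point at time `1`, `η(x, v) = x_M + (1 - τ_M) w_M`, of the specularly reflected
trajectory in the ball with centre `a` and radius `r` that starts at `x` with velocity `v`. -/
def eta (a : E d) (r : ℝ) (x v : E d) : E d :=
  (state a r x v (numRefl a r x v)).1
    + (1 - reflTime a r x v (numRefl a r x v)) • (state a r x v (numRefl a r x v)).2

/-- The truncated integral `∫_{|w| > ε} (ψ(x) - ψ(η(x,w))) / |w|^{d+2s} dw`. -/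
def truncInt (a : E d) (r s : ℝ) (ψ : E d → ℝ) (x : E d) (ε : ℝ) : ℝ :=
  ∫ w in {w : E d | ε < ‖w‖}, (ψ x - ψ (eta a r x w)) / ‖w‖ ^ ((d : ℝ) + 2 * s)

/-- The specular diffusion operator on the ball with centre `a` and radius `r`:
`c_{d,s}` times the principal value of `∫ (ψ(x) - ψ(η(x,w))) / |w|^{d+2s} dw`. -/
def specularDiffusion [NeZero d] (a : E d) (r s : ℝ) (ψ : E d → ℝ) (x : E d) : ℝ :=
  fracConst d s * limUnder (𝓝[>] (0 : ℝ)) (truncInt a r s ψ x)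

end SpecularBall

end

/-! In the ball all chords of a trajectory are congruent: with the centre as origin, one linear
isometry, `turn`, carries each chord to the next. So the end point at time 1 is `turn ^ k` applied
to a point on the line of the first chord, where `k` is the number of reflections (`endPoint`,
`eta_eq`).

The formula rests on reversibility: Lebesgue measure on Ω × ℝ^d has the same image under (x, v) ↦
(x, η, |v|) and under (x, v) ↦ (η, x, |v|) (`map_etaExt_swap`). To prove it without differentiating
the billiard flow, fix v. Reversing time and restoring the velocity v by an isometry sends starting
points to starting points. This map is the reflection in v^⊥ followed by a shear along v, so it
preserves volume (`measurePreserving_reversal`), and an isometry takes the pair (start, end) to the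
pair (end, start) of the new trajectory (`exists_isometry_reversal`). Hence the exchange holds at
fixed v for integrands invariant under simultaneous isometries of both points. A general integrand
is replaced by its average over the orthogonal group, which leaves the integral over Ω × ℝ^d
unchanged because trajectories are equivariant (`lintegral_endPoint_swap`).

For convergence, the integrand is made even in v. Where the boundary is out of reach it is a second
difference, O(|v|²). Otherwise it is only O(|v|), but then x lies in a shell of volume O(|v|)
(`abs_evenJump_le`, `integrable_shellWeight_prod`). On |v| > ε, the integral of φ(x)(ψ(x) - ψ(η))
equals its exchanged copy, and the two add up to the energy (`setIntegral_mul_jump`). Dominated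
convergence lets ε tend to 0, and symmetry is read off from the energy. -/

noncomputable section

/-! ### Geometry of a chord and reversal of a trajectory -/

namespace SpecularBall

variable {V : Type*} [NormedAddCommGroup V] [InnerProductSpace ℝ V]

local notation "⟪" x ", " y "⟫" => inner ℝ x y

/-- The linear reflection of `ℝ^d` in the hyperplane orthogonal to `z`. -/
def refl (z : V) : V ≃ₗᵢ[ℝ] V := (ℝ ∙ z)ᗮ.reflection

lemma refl_apply (z w : V) : refl z w = w - (2 * (⟪z, w⟫ / ‖z‖ ^ 2)) • z := by
  rw [refl, Submodule.reflection_orthogonal_apply, Submodule.reflection_singleton_apply]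
  simp only [RCLike.ofReal_real_eq_id, id_eq, neg_sub, two_smul, two_mul, add_smul]

lemma refl_self (z : V) : refl z z = -z := by
  rcases eq_or_ne z 0 with rfl | h0
  · simp
  · rw [refl_apply, real_inner_self_eq_norm_sq, div_self (by positivity), mul_one, two_smul]
    abel

lemma refl_neg (z w : V) : refl (-z) w = refl z w := by
  simp [refl_apply, neg_div]

lemma refl_refl (z w : V) : refl z (refl z w) = w := Submodule.reflection_reflection _ _

lemma refl_map (g : V ≃ₗᵢ[ℝ] V) (z w : V) : refl (g z) (g w) = g (refl z w) := by
  simp [refl_apply]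

/-- The time at which the line `c + τ v` has passed its foot point. -/
def footTime (c v : V) : ℝ := ⟪v, c⟫ / ‖v‖ ^ 2

/-- The point closest to the origin on the line through `c` with direction `v`. -/
def foot (c v : V) : V := c - footTime c v • v

/-- The time needed for half the chord that the line through `c` cuts out of the ball. -/
def halfTime (r : ℝ) (c v : V) : ℝ := √(r ^ 2 - ‖foot c v‖ ^ 2) / ‖v‖

/-- The isometry that carries each chord of the trajectory to the next one. -/
def turn (r : ℝ) (c v : V) : V ≃ₗᵢ[ℝ] V :=
  refl (foot c v + halfTime r c v • v) * refl (foot c v)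

lemma turn_apply (r : ℝ) (c v z : V) :
    turn r c v z = refl (foot c v + halfTime r c v • v) (refl (foot c v) z) := rfl

lemma foot_add (c v : V) : foot c v + footTime c v • v = c := by simp [foot]

lemma inner_foot (c v : V) : ⟪foot c v, v⟫ = 0 := by
  rcases eq_or_ne v 0 with rfl | hv
  · simp
  have : ‖v‖ ^ 2 ≠ 0 := by positivity
  rw [foot, footTime, inner_sub_left, real_inner_smul_left, real_inner_self_eq_norm_sq,
    real_inner_comm]
  field_simp
  ring

lemma refl_foot_right (c v : V) : refl (foot c v) v = v := by simp [refl_apply, inner_foot]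

lemma refl_foot_left (c v : V) : refl v (foot c v) = foot c v := by
  simp [refl_apply, real_inner_comm (foot c v) v, inner_foot]

lemma norm_sq_foot_add (c v : V) (τ : ℝ) :
    ‖foot c v + τ • v‖ ^ 2 = ‖foot c v‖ ^ 2 + τ ^ 2 * ‖v‖ ^ 2 := by
  rw [norm_add_sq_real, real_inner_smul_right, inner_foot, norm_smul, mul_pow, Real.norm_eq_abs,
    sq_abs]
  ring

lemma norm_foot_add_lt {r : ℝ} (hr : 0 < r) {c v : V} (hv : v ≠ 0) (τ : ℝ) :
    ‖foot c v + τ • v‖ < r ↔ |τ| < halfTime r c v := by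
  have hv' : 0 < ‖v‖ := norm_pos_iff.2 hv
  rw [halfTime, lt_div_iff₀ hv', Real.lt_sqrt (by positivity), mul_pow, sq_abs,
    ← abs_of_nonneg (norm_nonneg (foot c v + τ • v)), ← abs_of_pos hr, ← sq_lt_sq, abs_of_pos hr,
    norm_sq_foot_add]
  constructor <;> intro h <;> linarith

/-- Positivity of `halfTime` excludes the default value 0 of the square root at negative arguments,
so the line really crosses the ball. -/
lemma halfTime_sq {r : ℝ} {c v : V} (hv : v ≠ 0) (h : 0 < halfTime r c v) :
    ‖foot c v‖ ^ 2 + halfTime r c v ^ 2 * ‖v‖ ^ 2 = r ^ 2 := by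
  have hv' : 0 < ‖v‖ := norm_pos_iff.2 hv
  have h1 : 0 < r ^ 2 - ‖foot c v‖ ^ 2 := by
    by_contra! hc
    rw [halfTime, Real.sqrt_eq_zero_of_nonpos hc] at h
    simp at h
  rw [halfTime, div_pow, Real.sq_sqrt h1.le]
  field_simp
  ring

lemma norm_foot_add_eq {r : ℝ} (hr : 0 < r) {c v : V} (hv : v ≠ 0) (h : 0 < halfTime r c v)
    (τ : ℝ) : ‖foot c v + τ • v‖ = r ↔ |τ| = halfTime r c v := by
  have hv' : 0 < ‖v‖ := norm_pos_iff.2 hv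
  rw [← sq_eq_sq₀ (norm_nonneg _) hr.le, norm_sq_foot_add, ← halfTime_sq hv h,
    ← sq_eq_sq₀ (abs_nonneg _) h.le, sq_abs, add_right_inj]
  exact mul_left_inj' (by positivity)

/-- The number of reflections before time `1`, in closed form. -/
def bounces (r : ℝ) (c v : V) : ℕ :=
  ⌈(footTime c v + 1 - halfTime r c v) / (2 * halfTime r c v)⌉₊

/-- The position at time `1` relative to the foot point of the last chord. -/
def endTime (r : ℝ) (c v : V) (k : ℕ) : ℝ := footTime c v + 1 - 2 * k * halfTime r c v

lemma abs_footTime_lt {r : ℝ} (hr : 0 < r) {c v : V} (hv : v ≠ 0) :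
    |footTime c v| < halfTime r c v ↔ ‖c‖ < r := by
  rw [← norm_foot_add_lt hr hv, foot_add]

lemma abs_endTime_bounces_le {r : ℝ} {c v : V} (ht : |footTime c v| < halfTime r c v) :
    |endTime r c v (bounces r c v)| ≤ halfTime r c v := by
  have h : 0 < halfTime r c v := (abs_nonneg _).trans_lt ht
  obtain ⟨h1, h2⟩ := abs_lt.1 ht
  have h3 := Nat.le_ceil ((footTime c v + 1 - halfTime r c v) / (2 * halfTime r c v))
  rw [div_le_iff₀ (by positivity)] at h3
  rw [abs_le, endTime, bounces]
  refine ⟨?_, by linarith⟩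
  rcases le_or_gt 0 ((footTime c v + 1 - halfTime r c v) / (2 * halfTime r c v)) with h4 | h4
  · have h5 := Nat.ceil_lt_add_one h4
    rw [← sub_lt_iff_lt_add, lt_div_iff₀ (by positivity)] at h5
    linarith
  -- A negative quotient is truncated to zero reflections; the end is then later on the chord than
  -- the start, which already lies beyond `-halfTime`.
  · rw [Nat.ceil_eq_zero.2 h4.le, Nat.cast_zero]
    linarith

/-- The end point, relative to the centre, of the trajectory from `c` with velocity `v`. -/
def endPoint (r : ℝ) (c v : V) : V :=
  (turn r c v ^ bounces r c v) (foot c v + endTime r c v (bounces r c v) • v)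

/-- For different `k` the open intervals of admissible `footTime c v + 1` are disjoint, so an end
strictly inside the chord determines the number of reflections. -/
lemma bounces_eq {r : ℝ} {c v : V} {k : ℕ} (ht : |footTime c v| < halfTime r c v)
    (hk : |endTime r c v k| < halfTime r c v) : bounces r c v = k := by
  have h : 0 < halfTime r c v := (abs_nonneg _).trans_lt ht
  obtain ⟨h1, h2⟩ := abs_lt.1 hk
  rw [endTime] at h1 h2
  apply le_antisymm
  · rw [bounces, Nat.ceil_le, div_le_iff₀ (by positivity)]
    linarith
  · rcases k with _ | k
    · exact Nat.zero_le _
    · rw [Nat.succ_le_iff, bounces, Nat.lt_ceil, lt_div_iff₀ (by positivity)]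
      push_cast at h1
      linarith

lemma foot_foot_add (c v : V) (τ : ℝ) : foot (foot c v + τ • v) v = foot c v := by
  rcases eq_or_ne v 0 with rfl | hv
  · simp [foot]
  have : ‖v‖ ^ 2 ≠ 0 := by positivity
  rw [foot, footTime, inner_add_right, real_inner_comm, inner_foot, real_inner_smul_right,
    real_inner_self_eq_norm_sq, zero_add, mul_div_cancel_right₀ _ this, add_sub_cancel_right]

lemma footTime_foot_add (c : V) {v : V} (hv : v ≠ 0) (τ : ℝ) :
    footTime (foot c v + τ • v) v = τ := by
  have : ‖v‖ ^ 2 ≠ 0 := by positivity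
  rw [footTime, inner_add_right, real_inner_comm, inner_foot, real_inner_smul_right,
    real_inner_self_eq_norm_sq, zero_add, mul_div_cancel_right₀ _ this]

lemma halfTime_foot_add (r : ℝ) (c v : V) (τ : ℝ) :
    halfTime r (foot c v + τ • v) v = halfTime r c v := by
  rw [halfTime, foot_foot_add, halfTime]

lemma turn_foot_add (r : ℝ) (c v : V) (τ : ℝ) :
    turn r (foot c v + τ • v) v = turn r c v := by
  rw [turn, halfTime_foot_add, foot_foot_add, turn]

/-- The starting point on the first chord of the reversed trajectory with `k` reflections,
reflected so that its velocity is again `v`. -/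
def reversal (r : ℝ) (k : ℕ) (v c : V) : V := foot c v + (-endTime r c v k) • v

lemma footTime_reversal (r : ℝ) (k : ℕ) {v : V} (hv : v ≠ 0) (c : V) :
    footTime (reversal r k v c) v = -endTime r c v k := footTime_foot_add c hv _

lemma halfTime_reversal (r : ℝ) (k : ℕ) (v c : V) :
    halfTime r (reversal r k v c) v = halfTime r c v := halfTime_foot_add r c v _

lemma endTime_reversal (r : ℝ) (k : ℕ) {v : V} (hv : v ≠ 0) (c : V) :
    endTime r (reversal r k v c) v k = -footTime c v := by
  rw [endTime, footTime_reversal r k hv, halfTime_reversal, endTime]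
  ring

lemma refl_turn_aux (r : ℝ) (c v : V) :
    refl (foot c v) (refl v (foot c v + halfTime r c v • v))
      = -(foot c v + halfTime r c v • v) := by
  simp only [map_add, map_smul, refl_self, refl_foot_left, map_neg, refl_foot_right, neg_add,
    smul_neg]

/-- Write `turn` as R_e R_f with f the foot and e the exit point of the chord. Since R_f R_v maps e
to -e, it commutes with R_e; since R_v fixes f, it commutes with R_f. The reflections then cancel in
pairs: reversing the chord conjugates `turn` to its inverse. -/
lemma turn_refl_turn (r : ℝ) (c v : V) : turn r c v * refl v * turn r c v = refl v := by
  ext1 z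
  change turn r c v (refl v (turn r c v z)) = refl v z
  rw [turn_apply r c v z, turn_apply, ← refl_map (refl v), ← refl_map (refl (foot c v)),
    refl_turn_aux, refl_neg, refl_refl]
  have := refl_map (refl v) (foot c v) z
  rw [refl_foot_left] at this
  rw [← this, refl_refl]

lemma turn_pow_refl_turn_pow (r : ℝ) (c v : V) (k : ℕ) :
    turn r c v ^ k * refl v * turn r c v ^ k = refl v := by
  induction k with
  | zero => simp
  | succ k ih =>
    calc turn r c v ^ (k + 1) * refl v * turn r c v ^ (k + 1)
        = turn r c v ^ k * (turn r c v * refl v * turn r c v) * turn r c v ^ k := by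
          nth_rw 2 [pow_succ']
          rw [pow_succ]
          simp only [mul_assoc]
      _ = refl v := by rw [turn_refl_turn, ih]

/-- An isometry carries the end points of a trajectory, in reversed order, to the end points of
the trajectory that starts at the reversal. -/
lemma exists_isometry_reversal {r : ℝ} {c v : V} {k : ℕ} (hv : v ≠ 0)
    (ht : |footTime c v| < halfTime r c v) (hk : |endTime r c v k| < halfTime r c v) :
    ∃ g : V ≃ₗᵢ[ℝ] V, g c = endPoint r (reversal r k v c) v ∧
      g (endPoint r c v) = reversal r k v c := by
  have ht' : |footTime (reversal r k v c) v| < halfTime r (reversal r k v c) v := by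
    rwa [footTime_reversal r k hv, halfTime_reversal, abs_neg]
  have hk' : |endTime r (reversal r k v c) v k| < halfTime r (reversal r k v c) v := by
    rwa [endTime_reversal r k hv, halfTime_reversal, abs_neg]
  have hσ (τ : ℝ) : refl v (foot c v + τ • v) = foot c v + (-τ) • v := by
    rw [map_add, map_smul, refl_self, refl_foot_left, smul_neg, neg_smul]
  -- `refl v` reverses the first chord about its foot, and `turn ^ k` moves it onto the last chord.
  refine ⟨turn r c v ^ k * refl v, ?_, ?_⟩
  · rw [endPoint, bounces_eq ht' hk', endTime_reversal r k hv, reversal, turn_foot_add,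
      foot_foot_add, ← hσ, foot_add]
    rfl
  · rw [endPoint, bounces_eq ht hk, reversal, ← hσ]
    exact congrArg (fun g : V ≃ₗᵢ[ℝ] V => g _) (turn_pow_refl_turn_pow r c v k)


lemma footTime_add_smul (c : V) {v : V} (hv : v ≠ 0) (τ : ℝ) :
    footTime (c + τ • v) v = footTime c v + τ := by
  have : ‖v‖ ^ 2 ≠ 0 := by positivity
  rw [footTime, inner_add_right, real_inner_smul_right, real_inner_self_eq_norm_sq, add_div,
    mul_div_cancel_right₀ _ this, footTime]

lemma foot_add_smul (c v : V) (τ : ℝ) : foot (c + τ • v) v = foot c v := by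
  nth_rw 1 [← foot_add c v]
  rw [add_assoc, ← add_smul, foot_foot_add]

lemma halfTime_add_smul (r : ℝ) (c v : V) (τ : ℝ) :
    halfTime r (c + τ • v) v = halfTime r c v := by
  rw [halfTime, foot_add_smul, halfTime]

/-- Positions in the ball from which a trajectory with velocity `v` has exactly `k` reflections
before time `1` and does not end on the boundary. -/
def bounceSet (r : ℝ) (v : V) (k : ℕ) : Set (V) :=
  {c | |footTime c v| < halfTime r c v ∧ |endTime r c v k| < halfTime r c v}

lemma pairwise_disjoint_bounceSet (r : ℝ) (v : V) :
    Pairwise (Function.onFun Disjoint (bounceSet r v)) := by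
  intro i j hij
  refine Set.disjoint_left.2 fun c hi hj => hij ?_
  rw [← bounces_eq hi.1 hi.2, bounces_eq hj.1 hj.2]

/-- Reversal exchanges `footTime` and `endTime` up to sign, so the two conditions trade places. -/
lemma reversal_preimage_bounceSet (r : ℝ) {v : V} (hv : v ≠ 0) (k : ℕ) :
    reversal r k v ⁻¹' bounceSet r v k = bounceSet r v k := by
  ext c
  simp only [bounceSet, Set.mem_preimage, Set.mem_ofPred_eq, footTime_reversal r k hv,
    endTime_reversal r k hv, halfTime_reversal, abs_neg, and_comm]

/-! ### Equivariance of trajectories under isometries -/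

section Equivariance

variable (g : V ≃ₗᵢ[ℝ] V) (r : ℝ) (c v : V)

lemma footTime_map : footTime (g c) (g v) = footTime c v := by simp [footTime]

lemma foot_map : foot (g c) (g v) = g (foot c v) := by simp [foot, footTime_map]

lemma halfTime_map : halfTime r (g c) (g v) = halfTime r c v := by simp [halfTime, foot_map]

lemma turn_pow_map (k : ℕ) (z : V) :
    (turn r (g c) (g v) ^ k) (g z) = g ((turn r c v ^ k) z) := by
  induction k generalizing z with
  | zero => rfl
  | succ k ih =>
    simp only [pow_succ]
    change (turn r (g c) (g v) ^ k) (turn r (g c) (g v) (g z)) = _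
    rw [turn_apply, foot_map, halfTime_map, ← map_smul, ← map_add, refl_map, refl_map, ih]
    rfl

lemma endPoint_map : endPoint r (g c) (g v) = g (endPoint r c v) := by
  simp only [endPoint, bounces, endTime, footTime_map, halfTime_map, foot_map]
  rw [← turn_pow_map, map_add g, map_smul g]

end Equivariance

end SpecularBall

end

noncomputable section

namespace SpecularBall

/-! ### Haar measure on the orthogonal group and averages -/

section OrthogonalGroup

variable {V : Type*} [NormedAddCommGroup V] [InnerProductSpace ℝ V] [FiniteDimensional ℝ V]

/-- The orthogonal group of `V`. -/
abbrev Orth (V : Type*) [NormedAddCommGroup V] [InnerProductSpace ℝ V]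
    [FiniteDimensional ℝ V] : Type _ := unitary (V →L[ℝ] V)

instance : ContinuousStar (V →L[ℝ] V) where
  continuous_star := (ContinuousLinearMap.adjoint (𝕜 := ℝ) (E := V) (F := V)).continuous

instance : CompactSpace (Orth V) := by
  refine isCompact_iff_compactSpace.1 ?_
  refine Metric.isCompact_of_isClosed_isBounded isClosed_unitary ?_
  refine (isBounded_iff_forall_norm_le).2 ⟨1, fun u hu => ?_⟩
  exact ContinuousLinearMap.opNorm_le_bound _ zero_le_one fun x => by
    rw [one_mul]; exact (Unitary.norm_map ⟨u, hu⟩ x).le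

/-- The normalised Haar measure of the orthogonal group. -/
def orthHaar (V : Type*) [NormedAddCommGroup V] [InnerProductSpace ℝ V]
    [FiniteDimensional ℝ V] : Measure (Orth V) := Measure.haarMeasure ⊤

instance : (orthHaar V).IsMulLeftInvariant := by unfold orthHaar; infer_instance

instance : IsProbabilityMeasure (orthHaar V) :=
  ⟨Measure.haarMeasure_self (K₀ := (⊤ : TopologicalSpace.PositiveCompacts (Orth V)))⟩

/-- The isometry of `V` given by the inverse of an element of the orthogonal group. -/
def invIso (g : Orth V) : V ≃ₗᵢ[ℝ] V := Unitary.linearIsometryEquiv g⁻¹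

/-- The reason for inverses in `invIso`: composition with `o` becomes a left translation of `g`,
under which Haar measure is invariant. -/
lemma invIso_apply_isometry (o : V ≃ₗᵢ[ℝ] V) (g : Orth V) (z : V) :
    invIso g (o z) = invIso ((Unitary.linearIsometryEquiv.symm o)⁻¹ * g) z := by
  simp [invIso]

/-- The average of `F` over simultaneous isometries of its two position arguments. -/
def average (F : V × V × ℝ → ENNReal) (q : V × V × ℝ) : ENNReal :=
  ∫⁻ g, F (invIso g q.1, invIso g q.2.1, q.2.2) ∂orthHaar V

lemma average_map (F : V × V × ℝ → ENNReal) (o : V ≃ₗᵢ[ℝ] V) (c y : V) (ρ : ℝ) :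
    average F (o c, o y, ρ) = average F (c, y, ρ) := by
  simp only [average, invIso_apply_isometry]
  exact lintegral_mul_left_eq_self (μ := orthHaar V)
    (fun g => F (invIso g c, invIso g y, ρ)) _

end OrthogonalGroup

variable {V : Type*} [NormedAddCommGroup V] [InnerProductSpace ℝ V] [FiniteDimensional ℝ V]
  [MeasurableSpace V] [BorelSpace V]

/-! ### Measurability of the end point -/

section Measurability

@[fun_prop]
lemma measurable_footTime : Measurable fun q : V × V => footTime q.1 q.2 := by
  unfold footTime; fun_prop

@[fun_prop]
lemma measurable_foot : Measurable fun q : V × V => foot q.1 q.2 := by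
  unfold foot; fun_prop

@[fun_prop]
lemma measurable_halfTime (r : ℝ) : Measurable fun q : V × V => halfTime r q.1 q.2 := by
  unfold halfTime; fun_prop

@[fun_prop]
lemma measurable_endTime (r : ℝ) (k : ℕ) :
    Measurable fun q : V × V => endTime r q.1 q.2 k := by
  unfold endTime; fun_prop

lemma measurable_bounces (r : ℝ) : Measurable fun q : V × V => bounces r q.1 q.2 := by
  unfold bounces
  exact Nat.measurable_ceil.comp (by fun_prop)

lemma measurable_turn (r : ℝ) :
    Measurable fun q : (V × V) × V => turn r q.1.1 q.1.2 q.2 := by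
  simp only [turn_apply, refl_apply]; fun_prop

lemma measurable_turn_pow (r : ℝ) (k : ℕ) :
    Measurable fun q : (V × V) × V => (turn r q.1.1 q.1.2 ^ k) q.2 := by
  induction k with
  | zero => exact measurable_snd
  | succ k ih =>
    simp only [pow_succ]
    exact ih.comp (measurable_fst.prodMk (measurable_turn r))

lemma measurable_endPoint (r : ℝ) : Measurable fun q : V × V => endPoint r q.1 q.2 := by
  have h : Measurable fun q : ℕ × (V × V) =>
      (turn r q.2.1 q.2.2 ^ q.1) (foot q.2.1 q.2.2 + endTime r q.2.1 q.2.2 q.1 • q.2.2) := by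
    -- The exponent varies with the point but takes countably many values, so each `k` is treated
    -- alone.
    refine measurable_from_prod_countable_right fun k => ?_
    have h1 : Measurable fun q : V × V =>
        (q, foot q.1 q.2 + endTime r q.1 q.2 k • q.2) := by fun_prop
    have h2 := (measurable_turn_pow r k).comp h1
    exact h2
  have h2 : Measurable fun q : V × V => (bounces r q.1 q.2, q) :=
    (measurable_bounces r).prodMk measurable_id
  have h3 := h.comp h2
  exact h3

end Measurability

/-! ### Shears and the invariance of volume under reversal -/

section Shear

/-- A shear in the direction `v` preserves Lebesgue measure. -/
lemma measurePreserving_shear (v : V) {γ : V → ℝ} (hγ : Measurable γ)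
    (h : ∀ c (τ : ℝ), γ (c + τ • v) = γ c) :
    MeasurePreserving (fun c => c + γ c • v) (volume : Measure (V)) volume := by
  have hm : Measurable fun c => c + γ c • v := by fun_prop
  refine ⟨hm, Measure.ext_of_lintegral _ fun f hf => ?_⟩
  rw [lintegral_map hf hm]
  -- A weight of total mass 1 on an auxiliary time τ replaces a choice of coordinates along `v`.
  -- Translating c by τ v turns the shear into a shift of τ by γ c, which the weight absorbs after
  -- Tonelli.
  let χ : ℝ → ENNReal := (Set.Icc (0 : ℝ) 1).indicator 1
  have hχ : Measurable χ := measurable_one.indicator measurableSet_Icc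
  have h1 : ∫⁻ τ, χ τ = 1 := by simp [χ]
  have h2 (b : ℝ) : ∫⁻ τ, χ (τ - b) = 1 := by rw [lintegral_sub_right_eq_self χ b, h1]
  calc ∫⁻ c, f (c + γ c • v)
      = ∫⁻ τ, χ τ * ∫⁻ c, f (c + γ c • v) := by
        rw [lintegral_mul_const _ hχ, h1, one_mul]
    _ = ∫⁻ τ, ∫⁻ c, χ τ * f (c + τ • v + γ c • v) := by
        refine lintegral_congr fun τ => ?_
        rw [← lintegral_add_right_eq_self _ (τ • v), lintegral_const_mul _ (by fun_prop)]
        simp only [h]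
    _ = ∫⁻ c, ∫⁻ τ, χ τ * f (c + τ • v + γ c • v) :=
        lintegral_lintegral_swap (by unfold Function.uncurry; fun_prop)
    _ = ∫⁻ c, ∫⁻ τ, χ (τ - γ c) * f (c + τ • v) := by
        refine lintegral_congr fun c => ?_
        rw [← lintegral_add_right_eq_self (fun τ => χ (τ - γ c) * f (c + τ • v)) (γ c)]
        simp only [add_sub_cancel_right, add_smul, add_assoc]
    _ = ∫⁻ τ, ∫⁻ c, χ (τ - γ c) * f (c + τ • v) :=
        lintegral_lintegral_swap (by unfold Function.uncurry; fun_prop)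
    _ = ∫⁻ τ, ∫⁻ c, χ (τ - γ c) * f c := by
        refine lintegral_congr fun τ => ?_
        rw [← lintegral_add_right_eq_self (fun c => χ (τ - γ c) * f c) (τ • v)]
        simp only [h]
    _ = ∫⁻ c, ∫⁻ τ, χ (τ - γ c) * f c :=
        lintegral_lintegral_swap (by unfold Function.uncurry; fun_prop)
    _ = ∫⁻ c, f c := by
        refine lintegral_congr fun c => ?_
        rw [lintegral_mul_const _ (by fun_prop), h2, one_mul]

lemma measurable_footTime_left (v : V) : Measurable fun c => footTime c v := by
  unfold footTime; fun_prop

lemma measurable_halfTime_left (r : ℝ) (v : V) : Measurable fun c => halfTime r c v := by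
  unfold halfTime foot footTime; fun_prop

lemma measurable_endTime_left (r : ℝ) (v : V) (k : ℕ) : Measurable fun c => endTime r c v k := by
  unfold endTime halfTime foot footTime; fun_prop

/-- The set is the preimage of the hyperplane v^⊥ under a shear along `v`. -/
lemma volume_footTime_add_eq_zero {v : V} (hv : v ≠ 0) {γ : V → ℝ} (hγ : Measurable γ)
    (h : ∀ c (τ : ℝ), γ (c + τ • v) = γ c) : volume {c : V | footTime c v + γ c = 0} = 0 := by
  have h0 : volume {c : V | footTime c v = 0} = 0 := by
    have e : {c : V | footTime c v = 0} = ((ℝ ∙ v)ᗮ : Submodule ℝ (V)) := by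
      ext c
      have : ‖v‖ ^ 2 ≠ 0 := by positivity
      simp [Submodule.mem_orthogonal_singleton_iff_inner_right, footTime, hv]
    rw [e]
    refine Measure.addHaar_submodule _ _ fun ht => hv ?_
    rwa [Submodule.orthogonal_eq_top_iff, Submodule.span_singleton_eq_bot] at ht
  have hm := (measurePreserving_shear v hγ h).measure_preimage
    (s := {c | footTime c v = 0}) (MeasurableSet.nullMeasurableSet
      (measurable_footTime_left v (measurableSet_singleton (0 : ℝ))))
  rw [h0] at hm
  rw [← hm]
  congr 1
  ext c
  simp [footTime_add_smul _ hv]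

/-- Reflection in v^⊥ negates `footTime`; a shear by `2 * k * halfTime - 1`, constant along each
line, then gives `-endTime`. -/
lemma measurePreserving_reversal (r : ℝ) (k : ℕ) (v : V) :
    MeasurePreserving (reversal r k v) (volume : Measure (V)) volume := by
  have hs := measurePreserving_shear v (γ := fun c => 2 * k * halfTime r c v - 1)
    (((measurable_halfTime_left r v).const_mul _).sub_const _)
    (fun c τ => by rw [halfTime_add_smul])
  have hc := hs.comp (refl v).measurePreserving
  suffices h : reversal r k v = (fun c => c + (2 * k * halfTime r c v - 1) • v) ∘ refl v by rwa [h]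
  funext c
  have e : refl v c = foot c v + (-footTime c v) • v := by
    nth_rw 1 [← foot_add c v]
    rw [map_add, map_smul, refl_self, refl_foot_left, smul_neg, neg_smul]
  rw [Function.comp_apply, e, halfTime_foot_add, reversal, endTime, add_assoc, ← add_smul]
  congr 2
  ring

end Shear

/-! ### Exchange of start and end at a fixed velocity -/

lemma measurableSet_bounceSet (r : ℝ) (v : V) (k : ℕ) : MeasurableSet (bounceSet r v k) := by
  have h1 := measurable_footTime_left v
  have h2 := measurable_endTime_left r v k
  have h3 := measurable_halfTime_left r v
  exact (measurableSet_lt (continuous_abs.measurable.comp h1) h3).inter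
    (measurableSet_lt (continuous_abs.measurable.comp h2) h3)

lemma ball_ae_eq_iUnion_bounceSet {r : ℝ} (hr : 0 < r) {v : V} (hv : v ≠ 0) :
    (Metric.ball 0 r : Set (V)) =ᵐ[volume] ⋃ k, bounceSet r v k := by
  -- With e = ±1 these are the trajectories that end on the sphere, a null set for each `k`.
  have hn (k : ℕ) (e : ℝ) : ∀ᵐ c : V, endTime r c v k ≠ e * halfTime r c v := by
    have := volume_footTime_add_eq_zero hv
      (γ := fun c => 1 - 2 * k * halfTime r c v - e * halfTime r c v)
      (by have := measurable_halfTime_left r v; fun_prop) (fun c τ => by rw [halfTime_add_smul])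
    rw [ae_iff]
    convert this using 2
    ext c
    simp only [ne_eq, not_not, endTime, Set.mem_ofPred_eq]
    constructor <;> intro h <;> linarith
  filter_upwards [ae_all_iff.2 fun k => hn k 1, ae_all_iff.2 fun k => hn k (-1)] with c h1 h2
  refine propext ⟨fun hc => ?_, fun hc => ?_⟩
  · have hc : ‖c‖ < r := mem_ball_zero_iff.1 hc
    have ht := (abs_footTime_lt hr hv).2 hc
    refine Set.mem_iUnion.2 ⟨bounces r c v, ht, (abs_endTime_bounces_le ht).lt_of_ne fun h => ?_⟩
    rcases eq_or_eq_neg_of_abs_eq h with h | h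
    · exact h1 _ (by rw [h, one_mul])
    · exact h2 _ (by rw [h, neg_one_mul])
  · obtain ⟨k, hk⟩ := Set.mem_iUnion.1 hc
    exact mem_ball_zero_iff.2 ((abs_footTime_lt hr hv).1 hk.1)

/-- Exchange of the end points of the trajectories, for a fixed velocity and an integrand that is
invariant under isometries. -/
lemma lintegral_endPoint_swap_of_invariant {r : ℝ} (hr : 0 < r) {v : V} (hv : v ≠ 0)
    {f : V × V → ENNReal} (hf : Measurable f)
    (h : ∀ (g : V ≃ₗᵢ[ℝ] V) c y, f (g c, g y) = f (c, y)) :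
    ∫⁻ c in Metric.ball 0 r, f (c, endPoint r c v)
      = ∫⁻ c in Metric.ball 0 r, f (endPoint r c v, c) := by
  simp only [setLIntegral_congr (ball_ae_eq_iUnion_bounceSet hr hv),
    lintegral_iUnion (measurableSet_bounceSet r v) (pairwise_disjoint_bounceSet r v)]
  congr 1
  ext1 k
  have hm : Measurable fun c => f (c, endPoint r c v) := by
    have hN := measurable_endPoint (V := V) r
    fun_prop
  -- Change of variables by the reversal; the isometry below then brings the pair back to that of
  -- `c`, in exchanged order.
  rw [← (measurePreserving_reversal r k v).setLIntegral_comp_preimage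
    (measurableSet_bounceSet r v k) hm, reversal_preimage_bounceSet r hv]
  refine setLIntegral_congr_fun (measurableSet_bounceSet r v k) fun c hc => ?_
  obtain ⟨g, h1, h2⟩ := exists_isometry_reversal hv hc.1 hc.2
  rw [← h1, ← h2, h]

/-! ### Exchange for general integrands by averaging -/

section Averaging

lemma measurable_invIso : Measurable fun q : Orth V × V => invIso q.1 q.2 := by
  have : Continuous fun q : Orth V × V => ((q.1⁻¹ : Orth V) : V →L[ℝ] V) q.2 :=
    (continuous_subtype_val.comp continuous_fst.inv).clm_apply continuous_snd
  exact this.measurable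

lemma measurable_average_integrand {F : V × V × ℝ → ENNReal} (hF : Measurable F) :
    Measurable fun z : (V × V × ℝ) × Orth V =>
      F (invIso z.2 z.1.1, invIso z.2 z.1.2.1, z.1.2.2) :=
  hF.comp ((measurable_invIso.comp (measurable_snd.prodMk measurable_fst.fst)).prodMk
    ((measurable_invIso.comp (measurable_snd.prodMk measurable_fst.snd.fst)).prodMk
      measurable_fst.snd.snd))

lemma measurable_average {F : V × V × ℝ → ENNReal} (hF : Measurable F) :
    Measurable (average F) :=
  (measurable_average_integrand hF).lintegral_prod_right'

lemma measurePreserving_isometry_ball (r : ℝ) (g : V ≃ₗᵢ[ℝ] V) :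
    MeasurePreserving (Prod.map g g)
      (((volume : Measure (V)).restrict (Metric.ball 0 r)).prod volume)
      (((volume : Measure (V)).restrict (Metric.ball 0 r)).prod volume) := by
  have h := g.measurePreserving.restrict_preimage (s := Metric.ball (0 : V) r)
    measurableSet_ball
  have e : g ⁻¹' Metric.ball (0 : V) r = Metric.ball 0 r := by ext z; simp
  rw [e] at h
  exact h.prod g.measurePreserving

/-- By Tonelli the integral over phase space may be taken first. For each `g`, equivariance of `T`
and invariance of the measure make it independent of `g`, and Haar measure has mass 1. -/
lemma lintegral_average {r : ℝ} {F : V × V × ℝ → ENNReal} (hF : Measurable F)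
    {T : V × V → V × V × ℝ} (hT : Measurable T)
    (h : ∀ (g : V ≃ₗᵢ[ℝ] V) q, T (g q.1, g q.2) = (g (T q).1, g (T q).2.1, (T q).2.2)) :
    ∫⁻ q, average F (T q) ∂(((volume : Measure (V)).restrict (Metric.ball 0 r)).prod volume)
      = ∫⁻ q, F (T q) ∂(((volume : Measure (V)).restrict (Metric.ball 0 r)).prod volume) := by
  simp only [average]
  have hm : Measurable (Function.uncurry fun (q : V × V) (g : Orth V) =>
      F (invIso g (T q).1, invIso g (T q).2.1, (T q).2.2)) := by
    have h1 : Measurable fun z : (V × V) × Orth V => (T z.1, z.2) := by fun_prop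
    have h2 := (measurable_average_integrand hF).comp h1
    exact h2
  rw [lintegral_lintegral_swap hm.aemeasurable]
  have (g : Orth V) :
      ∫⁻ q, F (invIso g (T q).1, invIso g (T q).2.1, (T q).2.2)
        ∂(((volume : Measure (V)).restrict (Metric.ball 0 r)).prod volume)
      = ∫⁻ q, F (T q) ∂(((volume : Measure (V)).restrict (Metric.ball 0 r)).prod volume) := by
    rw [← (measurePreserving_isometry_ball r (invIso g)).lintegral_comp
      (f := fun q => F (T q)) (hF.comp hT)]
    simp only [← h]
    rfl
  simp only [this, lintegral_const, measure_univ, mul_one]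

end Averaging

/-- The isometry of the reversal depends on the starting point, so the exchange at fixed `v` needs
an invariant integrand. `average F` is one, as `F` sees the velocity only through its norm. -/
lemma lintegral_endPoint_swap [Nontrivial V] {r : ℝ} (hr : 0 < r)
    {F : V × V × ℝ → ENNReal} (hF : Measurable F) :
    ∫⁻ q, F (q.1, endPoint r q.1 q.2, ‖q.2‖)
        ∂(((volume : Measure (V)).restrict (Metric.ball 0 r)).prod volume)
      = ∫⁻ q, F (endPoint r q.1 q.2, q.1, ‖q.2‖)
        ∂(((volume : Measure (V)).restrict (Metric.ball 0 r)).prod volume) := by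
  have hN := measurable_endPoint (V := V) r
  have hT1 : Measurable fun q : V × V => (q.1, endPoint r q.1 q.2, ‖q.2‖) := by fun_prop
  have hT2 : Measurable fun q : V × V => (endPoint r q.1 q.2, q.1, ‖q.2‖) := by fun_prop
  rw [← lintegral_average hF hT1 (by simp [endPoint_map]),
    ← lintegral_average hF hT2 (by simp [endPoint_map])]
  have hA := measurable_average hF
  rw [lintegral_prod_symm _ (by fun_prop), lintegral_prod_symm _ (by fun_prop)]
  have h0 : ∀ᵐ v : V, v ≠ 0 := by
    rw [ae_iff]; simp
  refine lintegral_congr_ae ?_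
  filter_upwards [h0] with v hv
  exact lintegral_endPoint_swap_of_invariant hr hv (f := fun q => average F (q.1, q.2, ‖v‖))
    ((measurable_average hF).comp (by fun_prop)) fun g c y => average_map F g c y _

end SpecularBall

end

/-! ### The recursive trajectory in closed form -/

noncomputable section

namespace SpecularBall

variable {d : ℕ}

lemma reflect_add (a z w : E d) : reflect a (a + z) w = refl z w := by
  rw [reflect, normal, refl_apply, add_sub_cancel_left, real_inner_smul_left, smul_smul]
  congr 2
  rw [div_eq_mul_inv, ← inv_pow]
  ring

/-- The isometry `g` of `ℝ^d`, centred at `a`, acting on positions and velocities. -/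
def act (a : E d) (g : E d ≃ₗᵢ[ℝ] E d) (q : E d × E d) : E d × E d :=
  (a + g (q.1 - a), g q.2)

lemma act_mul (a : E d) (g g' : E d ≃ₗᵢ[ℝ] E d) (q : E d × E d) :
    act a (g * g') q = act a g (act a g' q) := by
  simp [act]

lemma hitTime_act (a : E d) (r : ℝ) (g : E d ≃ₗᵢ[ℝ] E d) (q : E d × E d) :
    hitTime a r (act a g q).1 (act a g q).2 = hitTime a r q.1 q.2 := by
  simp only [hitTime, act, mem_sphere_iff_norm]
  congr 1
  ext t
  simp only [Set.mem_ofPred_eq]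
  have : a + g (q.1 - a) + t • g q.2 - a = g (q.1 + t • q.2 - a) := by
    simp only [map_sub, map_add, map_smul]; abel
  rw [this, LinearIsometryEquiv.norm_map]

lemma step_act (a : E d) (r : ℝ) (g : E d ≃ₗᵢ[ℝ] E d) (q : E d × E d) :
    step a r (act a g q) = act a g (step a r q) := by
  have h : (act a g q).1 + hitTime a r q.1 q.2 • (act a g q).2
      = a + g (q.1 + hitTime a r q.1 q.2 • q.2 - a) := by
    simp only [act, map_sub, map_add, map_smul]; abel
  simp only [step, hitTime_act, h]
  rw [reflect_add, show (act a g q).2 = g q.2 from rfl, refl_map]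
  simp only [act]
  rw [← reflect_add a, add_sub_cancel]

lemma state_succ (a : E d) (r : ℝ) (x v : E d) (k : ℕ) :
    state a r x v (k + 1) = step a r (state a r x v k) :=
  Function.iterate_succ_apply' _ _ _

lemma hitTime_nonneg (a : E d) (r : ℝ) (p w : E d) : 0 ≤ hitTime a r p w :=
  Real.sInf_nonneg fun _ ht => ht.1.le

lemma norm_reflect (a y v : E d) : ‖reflect a y v‖ = ‖v‖ := by
  rw [← add_sub_cancel a y, reflect_add, LinearIsometryEquiv.norm_map]

lemma norm_state_snd (a : E d) (r : ℝ) (x v : E d) (k : ℕ) : ‖(state a r x v k).2‖ = ‖v‖ := by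
  induction k with
  | zero => rfl
  | succ k ih => rw [state_succ, step, norm_reflect, ih]

lemma reflTime_succ (a : E d) (r : ℝ) (x v : E d) (k : ℕ) :
    reflTime a r x v (k + 1)
      = reflTime a r x v k + hitTime a r (state a r x v k).1 (state a r x v k).2 :=
  Finset.sum_range_succ _ _

lemma norm_state_fst_sub_le (a : E d) (r : ℝ) (x v : E d) (k : ℕ) :
    ‖(state a r x v k).1 - x‖ ≤ reflTime a r x v k * ‖v‖ := by
  induction k with
  | zero => simp [state, reflTime]
  | succ k ih =>
    rw [state_succ, step, reflTime_succ, add_mul]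
    simp only
    rw [add_sub_right_comm]
    refine (norm_add_le _ _).trans (add_le_add ih ?_)
    rw [norm_smul, norm_state_snd, Real.norm_of_nonneg (hitTime_nonneg ..)]

lemma reflTime_numRefl_le (a : E d) (r : ℝ) (x v : E d) :
    reflTime a r x v (numRefl a r x v) ≤ 1 := by
  rcases h : numRefl a r x v with _ | k
  · simp [reflTime]
  · by_contra! hc
    -- If the last reflection came after time 1, the index `k` would already qualify, against
    -- minimality.
    have : numRefl a r x v ≤ k := Nat.sInf_le hc.le
    omega

/-- The end point of the trajectory is at most at the distance `|v|` travelled. -/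
lemma norm_eta_sub_le (a : E d) (r : ℝ) (x v : E d) : ‖eta a r x v - x‖ ≤ ‖v‖ := by
  have h1 := reflTime_numRefl_le a r x v
  rw [eta, add_sub_right_comm]
  refine (norm_add_le _ _).trans ((add_le_add (norm_state_fst_sub_le ..) le_rfl).trans ?_)
  rw [norm_smul, norm_state_snd, Real.norm_of_nonneg (by linarith)]
  apply le_of_eq; ring

/-- The value `τ = -halfTime` is allowed because after a reflection the motion starts on the sphere;
the condition 0 < t discards that point. -/
lemma hitTime_foot_add {r : ℝ} (hr : 0 < r) (a : E d) {c v : E d} (hv : v ≠ 0)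
    (h : 0 < halfTime r c v) {τ : ℝ} (h1 : -halfTime r c v ≤ τ) (h2 : τ < halfTime r c v) :
    hitTime a r (a + (foot c v + τ • v)) v = halfTime r c v - τ := by
  have : {t : ℝ | 0 < t ∧ a + (foot c v + τ • v) + t • v ∈ Metric.sphere a r}
      = {halfTime r c v - τ} := by
    ext t
    have : a + (foot c v + τ • v) + t • v - a = foot c v + (τ + t) • v := by
      rw [add_smul]; abel
    rw [Set.mem_ofPred_eq, mem_sphere_iff_norm, this, norm_foot_add_eq hr hv h, abs_eq h.le,
      Set.mem_singleton_iff]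
    constructor
    · rintro ⟨h0, h3 | h3⟩ <;> linarith
    · rintro rfl
      exact ⟨by linarith, Or.inl (by ring)⟩
  rw [hitTime, this, csInf_singleton]

/-- `refl (foot c v)` fixes `v` and sends the entry point to the antipode of the exit point; the
reflection at the exit point then gives the exit point itself and the reflected velocity. -/
lemma step_foot_add {r : ℝ} (hr : 0 < r) (a : E d) {c v : E d} (hv : v ≠ 0)
    (h : 0 < halfTime r c v) {τ : ℝ} (h1 : -halfTime r c v ≤ τ) (h2 : τ < halfTime r c v) :
    step a r (a + (foot c v + τ • v), v)
      = act a (turn r c v) (a + (foot c v - halfTime r c v • v), v) := by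
  have e : a + (foot c v + τ • v) + (halfTime r c v - τ) • v
      = a + (foot c v + halfTime r c v • v) := by
    rw [sub_smul]; abel
  simp only [step, hitTime_foot_add hr a hv h h1 h2, e, reflect_add, act, turn_apply,
    add_sub_cancel_left, map_sub, map_smul, refl_foot_right, refl_self]
  refine Prod.ext ?_ rfl
  simp only
  rw [← map_smul, ← map_sub, ← neg_add', map_neg, refl_self, neg_neg]

lemma state_zero (a : E d) (r : ℝ) (x v : E d) : state a r x v 0 = (x, v) := rfl

/-- A step commutes with isometries, so each one reduces to the first chord traversed from its entry
point. The index starts at 1 since `c` itself is not an entry point. -/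
lemma state_foot_succ {r : ℝ} (hr : 0 < r) (a : E d) {c v : E d} (hv : v ≠ 0)
    (ht : |footTime c v| < halfTime r c v) (k : ℕ) :
    state a r (a + c) v (k + 1)
      = act a (turn r c v ^ (k + 1)) (a + (foot c v - halfTime r c v • v), v) := by
  have h : 0 < halfTime r c v := (abs_nonneg _).trans_lt ht
  obtain ⟨h1, h2⟩ := abs_lt.1 ht
  induction k with
  | zero =>
    rw [state_succ, state_zero, zero_add, pow_one, ← step_foot_add hr a hv h h1.le h2, foot_add]
  | succ k ih =>
    have := step_foot_add hr a hv h le_rfl (neg_lt_self h)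
    rw [neg_smul, ← sub_eq_add_neg] at this
    rw [state_succ, ih, step_act, this, ← act_mul, ← pow_succ]

lemma reflTime_foot_succ {r : ℝ} (hr : 0 < r) (a : E d) {c v : E d} (hv : v ≠ 0)
    (ht : |footTime c v| < halfTime r c v) (k : ℕ) :
    reflTime a r (a + c) v (k + 1)
      = halfTime r c v - footTime c v + 2 * halfTime r c v * k := by
  have h : 0 < halfTime r c v := (abs_nonneg _).trans_lt ht
  obtain ⟨h1, h2⟩ := abs_lt.1 ht
  induction k with
  | zero =>
    have := hitTime_foot_add hr a hv h h1.le h2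
    rw [foot_add] at this
    rw [reflTime_succ, state_zero, this]
    simp [reflTime]
  | succ k ih =>
    have := hitTime_foot_add hr a hv h le_rfl (neg_lt_self h)
    rw [neg_smul, ← sub_eq_add_neg] at this
    rw [reflTime_succ, ih, state_foot_succ hr a hv ht, hitTime_act]
    simp only [this]
    push_cast
    ring

lemma numRefl_eq {r : ℝ} (hr : 0 < r) (a : E d) {c v : E d} (hv : v ≠ 0)
    (ht : |footTime c v| < halfTime r c v) : numRefl a r (a + c) v = bounces r c v := by
  have h : 0 < halfTime r c v := (abs_nonneg _).trans_lt ht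
  have : {k : ℕ | 1 ≤ reflTime a r (a + c) v (k + 1)} = Set.Ici (bounces r c v) := by
    ext k
    rw [Set.mem_ofPred_eq, reflTime_foot_succ hr a hv ht, Set.mem_Ici, bounces, Nat.ceil_le,
      div_le_iff₀ (by positivity)]
    constructor <;> intro h <;> linarith
  rw [numRefl, this, csInf_Ici]

/-- The end point of the trajectory in closed form. -/
lemma eta_eq {r : ℝ} (hr : 0 < r) (a : E d) {c v : E d} (hc : ‖c‖ < r) :
    eta a r (a + c) v
      = a + endPoint r c v := by
  rcases eq_or_ne v 0 with rfl | hv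
  · have h0 : ‖eta a r (a + c) 0 - (a + c)‖ ≤ 0 := by simpa using norm_eta_sub_le a r (a + c) 0
    rw [sub_eq_zero.1 (norm_le_zero_iff.1 h0)]
    -- At `v = 0` division by zero makes `halfTime` and `bounces` vanish, so the closed form returns
    -- `c`.
    simp [endPoint, bounces, halfTime, foot]
  have ht := (abs_footTime_lt hr hv).2 hc
  rw [eta, numRefl_eq hr a hv ht, endPoint]
  rcases bounces r c v with _ | k
  · simp only [state_zero, reflTime, endTime]
    nth_rw 1 [← foot_add c v]
    simp only [Finset.range_zero, Finset.sum_empty, sub_zero, one_smul, pow_zero,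
      CharP.cast_eq_zero, mul_zero, zero_mul, add_smul, add_assoc]
    rfl
  · rw [reflTime_foot_succ hr a hv ht, state_foot_succ hr a hv ht]
    simp only [act, add_sub_cancel_left, endTime]
    rw [add_assoc, ← map_smul, ← map_add]
    congr 2
    rw [sub_eq_add_neg, add_assoc, ← neg_smul, ← add_smul]
    congr 2
    push_cast
    ring

lemma eta_mem_closedBall {r : ℝ} (hr : 0 < r) (a : E d) {c : E d} (hc : ‖c‖ < r) (v : E d) :
    ‖eta a r (a + c) v - a‖ ≤ r := by
  rcases eq_or_ne v 0 with rfl | hv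
  · have h0 : ‖eta a r (a + c) 0 - (a + c)‖ ≤ 0 := by simpa using norm_eta_sub_le a r (a + c) 0
    rw [sub_eq_zero.1 (norm_le_zero_iff.1 h0), add_sub_cancel_left]
    exact hc.le
  have ht := (abs_footTime_lt hr hv).2 hc
  have h : 0 < halfTime r c v := (abs_nonneg _).trans_lt ht
  rw [eta_eq hr a hc, endPoint, add_sub_cancel_left, LinearIsometryEquiv.norm_map,
    ← sq_le_sq₀ (norm_nonneg _) hr.le, norm_sq_foot_add, ← halfTime_sq hv h]
  gcongr _ + ?_ * _
  exact sq_le_sq.2 ((abs_endTime_bounces_le ht).trans (le_abs_self _))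

lemma eta_eq_add {r : ℝ} (hr : 0 < r) (a : E d) {c v : E d} (hc : ‖c‖ < r) (hcv : ‖c + v‖ < r) :
    eta a r (a + c) v = a + c + v := by
  rcases eq_or_ne v 0 with rfl | hv
  · have h0 : ‖eta a r (a + c) 0 - (a + c)‖ ≤ 0 := by simpa using norm_eta_sub_le a r (a + c) 0
    rw [sub_eq_zero.1 (norm_le_zero_iff.1 h0), add_zero]
  have ht := (abs_footTime_lt hr hv).2 hc
  have e : c + v = foot c v + endTime r c v 0 • v := by
    nth_rw 1 [← foot_add c v]
    simp [endTime, add_smul, add_assoc]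
  rw [e, norm_foot_add_lt hr hv] at hcv
  rw [eta_eq hr a hc, endPoint, bounces_eq ht hcv, ← e, add_assoc]
  rfl
lemma eta_eq_endPoint {r : ℝ} (hr : 0 < r) (a : E d) {x : E d} (hx : x ∈ Metric.ball a r)
    (v : E d) : eta a r x v = a + endPoint r (x - a) v := by
  rw [← eta_eq hr a (mem_ball_iff_norm.1 hx), add_sub_cancel]

/-- `eta a r`, extended measurably to starting points outside of the ball. -/
def etaExt (a : E d) (r : ℝ) (x v : E d) : E d := a + endPoint r (x - a) v

lemma measurable_etaExt (a : E d) (r : ℝ) :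
    Measurable fun q : E d × E d => etaExt a r q.1 q.2 := by
  have := measurable_endPoint (V := E d) r
  unfold etaExt; fun_prop

/-- Reversibility of the trajectories: starting points and end points are exchangeable with
respect to Lebesgue measure on `Ω × ℝ^d`. -/
lemma map_etaExt_swap [NeZero d] (a : E d) {r : ℝ} (hr : 0 < r) :
    Measure.map (fun q : E d × E d => (q.1, etaExt a r q.1 q.2, ‖q.2‖))
        (volume.restrict (Metric.ball a r ×ˢ Set.univ))
      = Measure.map (fun q : E d × E d => (etaExt a r q.1 q.2, q.1, ‖q.2‖))
        (volume.restrict (Metric.ball a r ×ˢ Set.univ)) := by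
  have hm := measurable_etaExt a r
  refine Measure.ext_of_lintegral _ fun F hF => ?_
  rw [lintegral_map hF (by fun_prop), lintegral_map hF (by fun_prop), Measure.volume_eq_prod,
    ← Measure.prod_restrict, Measure.restrict_univ]
  have h1 := (measurePreserving_add_left (volume : Measure (E d)) a).restrict_preimage
    (s := Metric.ball a r) measurableSet_ball
  have e : (a + ·) ⁻¹' Metric.ball a r = Metric.ball (0 : E d) r := by
    ext z; simp
  rw [e] at h1
  have h2 := h1.prod (MeasurePreserving.id (volume : Measure (E d)))
  rw [← h2.lintegral_comp (f := fun q => F (q.1, etaExt a r q.1 q.2, ‖q.2‖)) (by fun_prop),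
    ← h2.lintegral_comp (f := fun q => F (etaExt a r q.1 q.2, q.1, ‖q.2‖)) (by fun_prop)]
  have := lintegral_endPoint_swap hr (F := fun q => F (a + q.1, a + q.2.1, q.2.2)) (by fun_prop)
  simpa [etaExt] using this

end SpecularBall

end

/-! ### Regularity, kernel and shell estimates -/

noncomputable section

namespace SpecularBall

section Estimates

variable {V : Type*} [NormedAddCommGroup V] [InnerProductSpace ℝ V]

/-- The bounds on a function in the closed ball that the integration by parts formula needs. -/
structure IsRegular (a : V) (r C : ℝ) (ψ : V → ℝ) : Prop where
  nonneg : 0 ≤ C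
  bound : ∀ x ∈ Metric.closedBall a r, |ψ x| ≤ C
  lipschitz : ∀ x ∈ Metric.closedBall a r, ∀ y ∈ Metric.closedBall a r, |ψ x - ψ y| ≤ C * ‖x - y‖
  second : ∀ x v, x + v ∈ Metric.ball a r → x - v ∈ Metric.ball a r →
    |2 * ψ x - ψ (x + v) - ψ (x - v)| ≤ C * ‖v‖ ^ 2

/-- Mean value inequality for u ↦ ψ(x + u) + ψ(x - u) on the segment from 0 to v: its derivative
Dψ(x + u) - Dψ(x - u) has norm at most K · 2|v|. The points stay in the open ball, where
`fderivWithin` is a true derivative. -/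
lemma abs_second_difference_le {a : V} {r : ℝ} {ψ : V → ℝ}
    (hψ : DifferentiableOn ℝ ψ (Metric.closedBall a r)) {K : NNReal}
    (hK : LipschitzOnWith K (fderivWithin ℝ ψ (Metric.closedBall a r)) (Metric.closedBall a r))
    {x v : V} (h1 : x + v ∈ Metric.ball a r) (h2 : x - v ∈ Metric.ball a r) :
    |2 * ψ x - ψ (x + v) - ψ (x - v)| ≤ 2 * K * ‖v‖ ^ 2 := by
  have hseg : ∀ u ∈ segment ℝ 0 v, x + u ∈ Metric.ball a r ∧ x - u ∈ Metric.ball a r ∧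
      ‖u‖ ≤ ‖v‖ := by
    have hx : x ∈ Metric.ball a r := by
      have := (convex_ball a r) h1 h2 (a := 1 / 2) (b := 1 / 2) (by norm_num) (by norm_num)
        (by norm_num)
      convert this using 1
      module
    rintro _ ⟨p, q, hp, hq, hpq, rfl⟩
    refine ⟨?_, ?_, ?_⟩
    · convert (convex_ball a r) hx h1 hp hq hpq using 1
      rw [eq_sub_of_add_eq hpq]
      module
    · convert (convex_ball a r) hx h2 hp hq hpq using 1
      rw [eq_sub_of_add_eq hpq]
      module
    · rw [smul_zero, zero_add, norm_smul, Real.norm_of_nonneg hq]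
      exact mul_le_of_le_one_left (norm_nonneg _) (by linarith)
  have hd {y : V} (hy : y ∈ Metric.ball a r) :
      HasFDerivAt ψ (fderivWithin ℝ ψ (Metric.closedBall a r) y) y :=
    (hψ y (Metric.ball_subset_closedBall hy)).hasFDerivWithinAt.hasFDerivAt
      (mem_of_superset (Metric.isOpen_ball.mem_nhds hy) Metric.ball_subset_closedBall)
  have key := Convex.norm_image_sub_le_of_norm_hasFDerivWithin_le (𝕜 := ℝ)
    (f := fun u => ψ (x + u) + ψ (x - u)) (s := segment ℝ 0 v) (x := 0) (y := v)
    (f' := fun u => fderivWithin ℝ ψ (Metric.closedBall a r) (x + u)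
      - fderivWithin ℝ ψ (Metric.closedBall a r) (x - u)) (C := K * (2 * ‖v‖))
    (fun u hu => by
      obtain ⟨hu1, hu2, -⟩ := hseg u hu
      have e1 := (hd hu1).comp u ((hasFDerivAt_id u).const_add x)
      have e2 := (hd hu2).comp u ((hasFDerivAt_id u).const_sub x)
      have := (e1.add e2).hasFDerivWithinAt (s := segment ℝ 0 v)
      rw [ContinuousLinearMap.comp_id, ContinuousLinearMap.comp_neg,
        ContinuousLinearMap.comp_id, ← sub_eq_add_neg] at this
      exact this)
    (fun u hu => by
      obtain ⟨hu1, hu2, hu3⟩ := hseg u hu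
      have := hK.dist_le_mul _ (Metric.ball_subset_closedBall hu1) _
        (Metric.ball_subset_closedBall hu2)
      rw [dist_eq_norm, dist_eq_norm] at this
      refine this.trans (mul_le_mul_of_nonneg_left ?_ K.2)
      have e : x + u - (x - u) = (2 : ℝ) • u := by module
      rw [e, norm_smul, Real.norm_ofNat]
      linarith)
    (convex_segment _ _) (left_mem_segment _ _ _) (right_mem_segment _ _ _)
  rw [Real.norm_eq_abs, sub_zero, abs_sub_comm, add_zero, sub_zero] at key
  calc _ = |ψ x + ψ x - (ψ (x + v) + ψ (x - v))| := by congr 1; ring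
    _ ≤ _ := key
    _ = _ := by ring

lemma IsRegular.mono {V : Type*} [NormedAddCommGroup V] {a : V} {r C C' : ℝ}
    {ψ : V → ℝ} (h : IsRegular a r C ψ) (hC : C ≤ C') :
    IsRegular a r C' ψ where
  nonneg := h.nonneg.trans hC
  bound x hx := (h.bound x hx).trans hC
  lipschitz x hx y hy :=
    (h.lipschitz x hx y hy).trans (mul_le_mul_of_nonneg_right hC (norm_nonneg _))
  second x v h1 h2 := (h.second x v h1 h2).trans (mul_le_mul_of_nonneg_right hC (by positivity))

variable [FiniteDimensional ℝ V]

lemma exists_isRegular {a : V} {r : ℝ} (hr : 0 < r) {ψ : V → ℝ}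
    (hψ : ContDiffOn ℝ 2 ψ (Metric.closedBall a r)) : ∃ C, IsRegular a r C ψ := by
  have hcomp : IsCompact (Metric.closedBall a r) := isCompact_closedBall a r
  have hconv : Convex ℝ (Metric.closedBall a r) := convex_closedBall a r
  have huniq : UniqueDiffOn ℝ (Metric.closedBall a r) :=
    uniqueDiffOn_convex hconv
      ⟨a, mem_interior.2 ⟨_, Metric.ball_subset_closedBall, Metric.isOpen_ball,
        Metric.mem_ball_self hr⟩⟩
  obtain ⟨B, hB⟩ := hcomp.exists_bound_of_continuousOn hψ.continuousOn
  obtain ⟨L, hL⟩ := hψ.exists_lipschitzOnWith (by norm_num) hconv hcomp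
  obtain ⟨K, hK⟩ := (hψ.fderivWithin huniq (m := 1) (by norm_num)).exists_lipschitzOnWith
    one_ne_zero hconv hcomp
  have hB0 : 0 ≤ B := (norm_nonneg _).trans (hB a (Metric.mem_closedBall_self hr.le))
  have hL0 : (0 : ℝ) ≤ L := L.2
  have hK0 : (0 : ℝ) ≤ K := K.2
  refine ⟨B + L + 2 * K, by positivity, fun x hx => ?_, fun x hx y hy => ?_, fun x v h1 h2 => ?_⟩
  · have := hB x hx
    rw [Real.norm_eq_abs] at this
    linarith
  · have := hL.dist_le_mul x hx y hy
    rw [Real.dist_eq, dist_eq_norm] at this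
    exact this.trans (mul_le_mul_of_nonneg_right (by linarith) (norm_nonneg _))
  · exact (abs_second_difference_le (hψ.differentiableOn (by norm_num)) hK h1 h2).trans
      (mul_le_mul_of_nonneg_right (by linarith) (by positivity))

variable [MeasurableSpace V] [BorelSpace V]

/-- Removing a small neighbourhood of `ρ = 0` does not change an integral in the limit. -/
lemma tendsto_setIntegral_gt {α : Type*} [MeasurableSpace α] {μ : Measure α} {f : α → ℝ}
    (hf : Integrable f μ) {ρ : α → ℝ} (hρ : Measurable ρ) (h0 : ∀ᵐ x ∂μ, 0 < ρ x) :
    Tendsto (fun ε => ∫ x in {x | ε < ρ x}, f x ∂μ) (𝓝[>] (0 : ℝ)) (𝓝 (∫ x, f x ∂μ)) := by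
  have hm (ε : ℝ) : MeasurableSet {x | ε < ρ x} := measurableSet_lt measurable_const hρ
  simp only [← integral_indicator (hm _)]
  refine tendsto_integral_filter_of_dominated_convergence (fun x => ‖f x‖)
    (Eventually.of_forall fun ε => hf.aestronglyMeasurable.indicator (hm ε))
    (Eventually.of_forall fun ε => Eventually.of_forall fun x => norm_indicator_le_norm_self _ _)
    hf.norm ?_
  filter_upwards [h0] with x hx
  refine tendsto_const_nhds.congr' ?_
  filter_upwards [Ioo_mem_nhdsGT hx] with ε hε
  exact (Set.indicator_of_mem (s := {x | ε < ρ x}) hε.2 f).symm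

/-- The kernel `|v|^{-n-2s}`, `n` the dimension, is integrable against `min 1 |v|²`. -/
lemma integrable_min_sq_div [Nontrivial V] {s : ℝ} (hs0 : 0 < s) (hs1 : s < 1) :
    Integrable (fun v : V => min 1 (‖v‖ ^ 2) / ‖v‖ ^ ((Module.finrank ℝ V : ℝ) + 2 * s)) := by
  set n := Module.finrank ℝ V
  have hn : 1 ≤ n := Module.finrank_pos
  -- In polar coordinates the integrand is t^(1-2s) on (0, 1] and t^(-1-2s) beyond 1; the first
  -- needs s < 1, the second 0 < s.
  rw [integrable_fun_norm_addHaar volume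
    (f := fun t => min 1 (t ^ 2) / t ^ ((n : ℝ) + 2 * s)), ← Set.Ioc_union_Ioi_eq_Ioi zero_le_one,
    integrableOn_union]
  have hpow {t : ℝ} (ht : 0 < t) (b : ℝ) :
      t ^ (n - 1) • (t ^ b / t ^ ((n : ℝ) + 2 * s)) = t ^ (b - 1 - 2 * s) := by
    rw [smul_eq_mul, ← Real.rpow_natCast, ← Real.rpow_sub ht, ← Real.rpow_add ht, Nat.cast_sub hn]
    congr 1
    push_cast
    ring
  constructor
  · have h := (intervalIntegral.intervalIntegrable_rpow' (a := 0) (b := 1) (r := 2 - 1 - 2 * s)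
      (by linarith)).1
    refine h.congr_fun (fun t ht => ?_) measurableSet_Ioc
    have h1 : t ^ 2 ≤ 1 := pow_le_one₀ ht.1.le ht.2
    simp only
    rw [min_eq_right h1, ← hpow ht.1, Real.rpow_two]
  · refine (integrableOn_Ioi_rpow_of_lt (a := 0 - 1 - 2 * s) (by linarith) zero_lt_one).congr_fun
      (fun t ht => ?_) measurableSet_Ioi
    have ht : 1 < t := ht
    simp only
    rw [min_eq_left (one_le_pow₀ ht.le), ← hpow (by linarith), Real.rpow_zero]

/-- The volume of a shell at the boundary of a ball is at most proportional to its width. -/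
lemma exists_volume_shell_le [Nontrivial V] (a : V) {r : ℝ} (hr : 0 < r) :
    ∃ C, 0 ≤ C ∧ ∀ τ, 0 ≤ τ →
      volume.real {x | x ∈ Metric.ball a r ∧ r - τ ≤ ‖x - a‖} ≤ C * min 1 τ := by
  set n := Module.finrank ℝ V
  set ω := volume.real (Metric.ball (0 : V) 1)
  have hω : 0 ≤ ω := measureReal_nonneg
  have hball {t : ℝ} (ht : 0 ≤ t) : volume.real (Metric.ball a t) = t ^ n * ω := by
    rw [measureReal_def, Measure.addHaar_ball _ _ ht, ENNReal.toReal_mul,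
      ENNReal.toReal_ofReal (by positivity)]
    rfl
  have hfin (t : ℝ) : volume (Metric.ball a t) ≠ ⊤ := measure_ball_lt_top.ne
  have hle (τ : ℝ) : volume.real {x | x ∈ Metric.ball a r ∧ r - τ ≤ ‖x - a‖} ≤ r ^ n * ω := by
    rw [← hball hr.le]
    exact measureReal_mono (fun x hx => hx.1) (hfin r)
  have hlin {τ : ℝ} (hτ : 0 ≤ τ) : volume.real {x | x ∈ Metric.ball a r ∧ r - τ ≤ ‖x - a‖}
      ≤ (n + 1) * (r ^ n * ω / r) * τ := by
    rcases le_or_gt τ r with h | h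
    · have e : {x | x ∈ Metric.ball a r ∧ r - τ ≤ ‖x - a‖}
          = Metric.ball a r \ Metric.ball a (r - τ) := by
        ext x; simp [dist_eq_norm]
      rw [e, measureReal_sdiff (Metric.ball_subset_ball (by linarith)) measurableSet_ball (hfin r),
        hball hr.le, hball (by linarith)]
      -- Bernoulli's inequality bounds 1 - (1 - τ/r)^n by n τ/r; the constant n + 1 also serves the
      -- case τ > r.
      have hb := one_add_mul_le_pow (a := -(τ / r)) (by
        have : τ / r ≤ 1 := (div_le_one hr).2 h
        linarith) n
      have e2 : r - τ = r * (1 + -(τ / r)) := by field_simp; ring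
      rw [e2, mul_pow]
      have h3 : 0 ≤ r ^ n * ω := by positivity
      have h4 : 0 ≤ τ / r := by positivity
      have e3 : (n + 1) * (r ^ n * ω / r) * τ = (r ^ n * ω) * (n * (τ / r) + τ / r) := by
        field_simp
      rw [e3]
      nlinarith [mul_le_mul_of_nonneg_left hb h3, mul_nonneg h3 h4]
    · refine (hle τ).trans ?_
      have h4 : 1 ≤ τ / r := (one_le_div hr).2 h.le
      have e3 : (n + 1) * (r ^ n * ω / r) * τ = (r ^ n * ω) * ((n + 1) * (τ / r)) := by
        field_simp
      rw [e3]
      refine le_mul_of_one_le_right (by positivity) ?_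
      have : (1 : ℝ) ≤ n + 1 := by linarith [(Nat.cast_nonneg n : (0 : ℝ) ≤ n)]
      exact one_le_mul_of_one_le_of_one_le this h4
  refine ⟨r ^ n * ω + (n + 1) * (r ^ n * ω / r), by positivity, fun τ hτ => ?_⟩
  have h1 : 0 ≤ r ^ n * ω := by positivity
  have h2 : 0 ≤ (n + 1) * (r ^ n * ω / r) := by positivity
  rcases le_total 1 τ with h | h
  · rw [min_eq_left h]
    linarith [hle τ]
  · rw [min_eq_right h]
    refine (hlin hτ).trans (mul_le_mul_of_nonneg_right (by linarith) hτ)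

end Estimates

end SpecularBall

end

/-! ### Integration by parts for a reversible motion -/

noncomputable section

namespace SpecularBall

section IntegrationByParts

variable {V : Type*} [NormedAddCommGroup V] [InnerProductSpace ℝ V]

/-- The kernel of the fractional Laplacian of order `s`. -/
def kernel (V : Type*) [NormedAddCommGroup V] [InnerProductSpace ℝ V] (s t : ℝ) : ℝ :=
  t ^ ((Module.finrank ℝ V : ℝ) + 2 * s)

lemma kernel_nonneg {s t : ℝ} (ht : 0 ≤ t) : 0 ≤ kernel V s t := Real.rpow_nonneg ht _

@[fun_prop]
lemma measurable_kernel (s : ℝ) : Measurable (kernel V s) := by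
  unfold kernel; fun_prop

/-- The weight of velocities that can reach the boundary of the ball before time `1`. -/
def shellWeight (a : V) (r s : ℝ) (x v : V) : ℝ :=
  {q : V × V | r - ‖q.2‖ ≤ ‖q.1 - a‖}.indicator (fun q => min 1 ‖q.2‖ / kernel V s ‖q.2‖) (x, v)

lemma shellWeight_nonneg (a : V) (r s : ℝ) (x v : V) : 0 ≤ shellWeight a r s x v :=
  Set.indicator_nonneg (fun _ _ =>
    div_nonneg (le_min zero_le_one (norm_nonneg _)) (kernel_nonneg (norm_nonneg _))) _

variable [MeasurableSpace V] [BorelSpace V]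

lemma measurable_shellWeight (a : V) (r s : ℝ) :
    Measurable fun q : V × V => shellWeight a r s q.1 q.2 := by
  have hm : MeasurableSet {q : V × V | r - ‖q.2‖ ≤ ‖q.1 - a‖} :=
    measurableSet_le (by fun_prop) (by fun_prop)
  have h : Measurable fun q : V × V => min 1 ‖q.2‖ / kernel V s ‖q.2‖ := by fun_prop
  exact h.indicator hm

variable [FiniteDimensional ℝ V]

/-- Lebesgue measure on `Ω × V`, where `Ω` is the ball with centre `a` and radius `r`. -/
def phaseVolume (a : V) (r : ℝ) : Measure (V × V) :=
  (volume : Measure (V × V)).restrict (Metric.ball a r ×ˢ Set.univ)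

lemma phaseVolume_eq (a : V) (r : ℝ) :
    phaseVolume a r = ((volume : Measure V).restrict (Metric.ball a r)).prod volume := by
  rw [phaseVolume, Measure.volume_eq_prod, ← Measure.prod_restrict, Measure.restrict_univ]

/-- The properties of the end point `η x v` at time `1` of a motion in a ball that the
integration by parts formula needs. -/
structure IsReversibleMotion (a : V) (r : ℝ) (η : V → V → V) : Prop where
  measurable : Measurable fun q : V × V => η q.1 q.2
  mem : ∀ x ∈ Metric.ball a r, ∀ v, η x v ∈ Metric.closedBall a r
  dist_le : ∀ x ∈ Metric.ball a r, ∀ v, ‖x - η x v‖ ≤ ‖v‖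
  eq_add : ∀ x ∈ Metric.ball a r, ∀ v, x + v ∈ Metric.ball a r → η x v = x + v
  swap : Measure.map (fun q : V × V => (q.1, η q.1 q.2, ‖q.2‖)) (phaseVolume a r)
    = Measure.map (fun q : V × V => (η q.1 q.2, q.1, ‖q.2‖)) (phaseVolume a r)

/-- The integrand of the specular diffusion operator. -/
def jump (s : ℝ) (η : V → V → V) (ψ : V → ℝ) (x v : V) : ℝ :=
  (ψ x - ψ (η x v)) / kernel V s ‖v‖

/-- The integrand of the specular diffusion operator, made even in the velocity. -/
def evenJump (s : ℝ) (η : V → V → V) (ψ : V → ℝ) (x v : V) : ℝ :=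
  (jump s η ψ x v + jump s η ψ x (-v)) / 2

variable {a : V} {r s C : ℝ} {η : V → V → V} {φ ψ : V → ℝ}

lemma measurable_jump (hη : IsReversibleMotion a r η) (hψ : Measurable ψ) :
    Measurable fun q : V × V => jump s η ψ q.1 q.2 := by
  have := hη.measurable
  unfold jump
  fun_prop

lemma measurable_evenJump (hη : IsReversibleMotion a r η) (hψ : Measurable ψ) :
    Measurable fun q : V × V => evenJump s η ψ q.1 q.2 := by
  have h := measurable_jump (s := s) hη hψ
  have h' := h.comp (measurable_fst.prodMk measurable_snd.neg)
  exact (h.add h').div_const 2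

lemma abs_sub_eta_le (hη : IsReversibleMotion a r η) (hψ : IsRegular a r C ψ) {x : V}
    (hx : x ∈ Metric.ball a r) (v : V) : |ψ x - ψ (η x v)| ≤ 2 * C * min 1 ‖v‖ := by
  have hx' := Metric.ball_subset_closedBall hx
  have hC := hψ.nonneg
  rcases le_total 1 ‖v‖ with h | h
  · rw [min_eq_left h]
    have h1 := abs_le.1 (hψ.bound x hx')
    have h2 := abs_le.1 (hψ.bound _ (hη.mem x hx v))
    rw [abs_le]
    constructor <;> linarith [h1.1, h1.2, h2.1, h2.2]
  · rw [min_eq_right h]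
    calc _ ≤ C * ‖x - η x v‖ := hψ.lipschitz x hx' _ (hη.mem x hx v)
      _ ≤ C * ‖v‖ := mul_le_mul_of_nonneg_left (hη.dist_le x hx v) hC
      _ ≤ 2 * C * ‖v‖ := by nlinarith [norm_nonneg v]

lemma min_one_sq {t : ℝ} (ht : 0 ≤ t) : min 1 t * min 1 t = min 1 (t ^ 2) := by
  rcases le_total 1 t with h | h
  · rw [min_eq_left h, min_eq_left (one_le_pow₀ h), one_mul]
  · rw [min_eq_right h, min_eq_right (pow_le_one₀ ht h), sq]

/-- Far from the boundary both x + v and x - v are reached without reflection, and the second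
difference is quadratic in |v|. Inside the shell only the Lipschitz bound is available, which
`shellWeight` records. -/
lemma abs_evenJump_le (hη : IsReversibleMotion a r η) (hψ : IsRegular a r C ψ) {x : V}
    (hx : x ∈ Metric.ball a r) (v : V) :
    |evenJump s η ψ x v|
      ≤ 2 * C * (min 1 (‖v‖ ^ 2) / kernel V s ‖v‖ + shellWeight a r s x v) := by
  have hC := hψ.nonneg
  have hk : 0 ≤ kernel V s ‖v‖ := kernel_nonneg (norm_nonneg v)
  have e : evenJump s η ψ x v
      = ((ψ x - ψ (η x v)) + (ψ x - ψ (η x (-v)))) / 2 / kernel V s ‖v‖ := by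
    rw [evenJump, jump, jump, norm_neg]; ring
  have h1 := abs_le.1 (abs_sub_eta_le hη hψ hx v)
  have h2 := abs_le.1 (abs_sub_eta_le hη hψ hx (-v))
  rw [norm_neg] at h2
  rw [e, abs_div, abs_of_nonneg hk]
  by_cases hs : r - ‖v‖ ≤ ‖x - a‖
  · rw [shellWeight, Set.indicator_of_mem
      (show (x, v) ∈ {q : V × V | r - ‖q.2‖ ≤ ‖q.1 - a‖} from hs)]
    have h3 : |((ψ x - ψ (η x v)) + (ψ x - ψ (η x (-v)))) / 2| ≤ 2 * C * min 1 ‖v‖ := by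
      rw [abs_le]; constructor <;> linarith [h1.1, h1.2, h2.1, h2.2]
    have h4 : 0 ≤ 2 * C * (min 1 (‖v‖ ^ 2) / kernel V s ‖v‖) := by positivity
    have h5 := div_le_div_of_nonneg_right h3 hk
    rw [mul_div_assoc] at h5
    linarith
  · rw [shellWeight, Set.indicator_of_notMem
      (show (x, v) ∉ {q : V × V | r - ‖q.2‖ ≤ ‖q.1 - a‖} from hs), add_zero, ← mul_div_assoc]
    refine div_le_div_of_nonneg_right ?_ hk
    have hs' : ‖x - a‖ + ‖v‖ < r := by linarith
    have m1 : x + v ∈ Metric.ball a r := by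
      rw [mem_ball_iff_norm, add_sub_right_comm]
      exact (norm_add_le _ _).trans_lt hs'
    have m2 : x - v ∈ Metric.ball a r := by
      rw [mem_ball_iff_norm, sub_right_comm]
      exact (norm_sub_le _ _).trans_lt hs'
    rcases le_total 1 (‖v‖ ^ 2) with h | h
    · rw [min_eq_left h]
      have : min 1 ‖v‖ ≤ 1 := min_le_left _ _
      have h6 : 2 * C * min 1 ‖v‖ ≤ 2 * C * 1 := mul_le_mul_of_nonneg_left this (by linarith)
      rw [abs_le]; constructor <;> linarith [h1.1, h1.2, h2.1, h2.2]
    · rw [min_eq_right h, hη.eq_add x hx v m1,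
        hη.eq_add x hx (-v) (by rwa [← sub_eq_add_neg]), ← sub_eq_add_neg]
      have h6 := abs_le.1 (hψ.second x v m1 m2)
      have h7 : 0 ≤ C * ‖v‖ ^ 2 := by positivity
      rw [abs_le]; constructor <;> linarith [h6.1, h6.2]

lemma one_le_mul_min_sq {δ t : ℝ} (hδ : 0 < δ) (h : δ ≤ t) :
    1 ≤ (min 1 (δ ^ 2))⁻¹ * min 1 (t ^ 2) := by
  have h0 : 0 < min 1 (δ ^ 2) := by positivity
  rw [inv_mul_eq_div, one_le_div h0]
  gcongr

lemma ae_phaseVolume_mem (a : V) (r : ℝ) :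
    ∀ᵐ q ∂phaseVolume a r, q.1 ∈ Metric.ball a r := by
  filter_upwards [ae_restrict_mem (measurableSet_ball.prod MeasurableSet.univ)] with q hq
  exact hq.1

lemma integrable_phaseVolume_snd {f : V → ℝ} (hf : Integrable f) (a : V) (r : ℝ) :
    Integrable (fun q : V × V => f q.2) (phaseVolume a r) := by
  have : IsFiniteMeasure ((volume : Measure V).restrict (Metric.ball a r)) :=
    ⟨by rw [Measure.restrict_apply_univ]; exact measure_ball_lt_top⟩
  rw [phaseVolume_eq]
  exact hf.comp_snd _

variable [Nontrivial V]

/-- For a fixed interior point the weight vanishes for |v| below the distance to the sphere, so the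
singularity at v = 0 is not seen. -/
lemma integrable_shellWeight (hs0 : 0 < s) (hs1 : s < 1) {x : V} (hx : x ∈ Metric.ball a r) :
    Integrable (fun v => shellWeight a r s x v) := by
  have hδ : 0 < r - ‖x - a‖ := sub_pos.2 (mem_ball_iff_norm.1 hx)
  have hm : Measurable fun v => shellWeight a r s x v :=
    (measurable_shellWeight a r s).comp measurable_prodMk_left
  refine ((integrable_min_sq_div (V := V) hs0 hs1).const_mul
    (min 1 ((r - ‖x - a‖) ^ 2))⁻¹).mono' hm.aestronglyMeasurable (Eventually.of_forall fun v => ?_)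
  rw [Real.norm_of_nonneg (shellWeight_nonneg ..), ← mul_div_assoc]
  have hk : 0 ≤ kernel V s ‖v‖ := kernel_nonneg (norm_nonneg v)
  by_cases hv : (x, v) ∈ {q : V × V | r - ‖q.2‖ ≤ ‖q.1 - a‖}
  · rw [shellWeight, Set.indicator_of_mem hv]
    refine div_le_div_of_nonneg_right ((min_le_left _ _).trans (one_le_mul_min_sq hδ ?_)) hk
    have : r - ‖v‖ ≤ ‖x - a‖ := hv
    linarith
  · rw [shellWeight, Set.indicator_of_notMem hv]
    exact div_nonneg (by positivity) hk

/-- Integrating in x first, the volume of the shell supplies a second factor min 1 |v|, which makes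
the kernel integrable. -/
lemma integrable_shellWeight_prod (hs0 : 0 < s) (hs1 : s < 1) (a : V) (hr : 0 < r) :
    Integrable (fun q : V × V => shellWeight a r s q.1 q.2) (phaseVolume a r) := by
  obtain ⟨C, hC, hvol⟩ := exists_volume_shell_le a hr
  have hm := measurable_shellWeight a r s
  have hms (v : V) : MeasurableSet {x : V | r - ‖v‖ ≤ ‖x - a‖} :=
    measurableSet_le measurable_const (by fun_prop)
  have e (v : V) : (fun x => shellWeight a r s x v)
      = {x : V | r - ‖v‖ ≤ ‖x - a‖}.indicator fun _ => min 1 ‖v‖ / kernel V s ‖v‖ := rfl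
  have : IsFiniteMeasure ((volume : Measure V).restrict (Metric.ball a r)) :=
    ⟨by rw [Measure.restrict_apply_univ]; exact measure_ball_lt_top⟩
  rw [phaseVolume_eq, integrable_prod_iff' hm.aestronglyMeasurable]
  refine ⟨Eventually.of_forall fun v => ?_, ?_⟩
  · simp only [e]
    exact (integrable_const _).indicator (hms v)
  · refine ((integrable_min_sq_div (V := V) hs0 hs1).const_mul C).mono'
      hm.norm.stronglyMeasurable.integral_prod_left'.aestronglyMeasurable
      (Eventually.of_forall fun v => ?_)
    have hk : 0 ≤ kernel V s ‖v‖ := kernel_nonneg (norm_nonneg v)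
    simp only [Real.norm_of_nonneg (shellWeight_nonneg ..)]
    rw [Real.norm_of_nonneg (integral_nonneg fun x => shellWeight_nonneg ..)]
    simp only [e]
    rw [integral_indicator_const _ (hms v), measureReal_restrict_apply (hms v), smul_eq_mul,
      ← mul_div_assoc, ← mul_div_assoc]
    refine div_le_div_of_nonneg_right ?_ hk
    rw [← min_one_sq (norm_nonneg v), ← mul_assoc]
    refine mul_le_mul_of_nonneg_right ?_ (by positivity)
    rw [Set.inter_comm]
    exact hvol ‖v‖ (norm_nonneg v)

lemma ae_norm_pos : ∀ᵐ v : V, 0 < ‖v‖ := by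
  simp only [norm_pos_iff, ae_iff, not_not]
  simp

lemma ae_phaseVolume_norm_pos (a : V) (r : ℝ) : ∀ᵐ q ∂phaseVolume a r, 0 < ‖q.2‖ := by
  rw [phaseVolume_eq]
  exact Measure.quasiMeasurePreserving_snd.ae (ae_norm_pos (V := V))

/-- The truncated integrals that define the specular diffusion operator converge absolutely. -/
lemma integrableOn_jump (hs0 : 0 < s) (hs1 : s < 1) (hη : IsReversibleMotion a r η)
    (hψ : IsRegular a r C ψ) (hm : Measurable ψ) {x : V} (hx : x ∈ Metric.ball a r) {ε : ℝ}
    (hε : 0 < ε) : IntegrableOn (fun v => jump s η ψ x v) {v | ε < ‖v‖} := by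
  have hC := hψ.nonneg
  have hm' : Measurable fun v => jump s η ψ x v :=
    (measurable_jump hη hm).comp measurable_prodMk_left
  refine ((integrable_min_sq_div (V := V) hs0 hs1).const_mul
    (2 * C * (min 1 (ε ^ 2))⁻¹)).integrableOn.mono' hm'.aestronglyMeasurable ?_
  filter_upwards [ae_restrict_mem (measurableSet_lt measurable_const measurable_norm)] with v hv
  have hv : ε < ‖v‖ := hv
  have hk : 0 ≤ kernel V s ‖v‖ := kernel_nonneg (norm_nonneg v)
  rw [jump, norm_div, Real.norm_of_nonneg hk, ← mul_div_assoc, mul_assoc]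
  refine div_le_div_of_nonneg_right ((abs_sub_eta_le hη hψ hx v).trans ?_) hk
  exact mul_le_mul_of_nonneg_left ((min_le_left _ _).trans (one_le_mul_min_sq hε hv.le))
    (by linarith)

lemma integrable_evenJump (hs0 : 0 < s) (hs1 : s < 1) (hη : IsReversibleMotion a r η)
    (hψ : IsRegular a r C ψ) (hm : Measurable ψ) {x : V} (hx : x ∈ Metric.ball a r) :
    Integrable (fun v => evenJump s η ψ x v) := by
  have hm' : Measurable fun v => evenJump s η ψ x v :=
    (measurable_evenJump hη hm).comp measurable_prodMk_left
  exact (((integrable_min_sq_div hs0 hs1).add (integrable_shellWeight hs0 hs1 hx)).const_mul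
    (2 * C)).mono' hm'.aestronglyMeasurable
    (Eventually.of_forall fun v => abs_evenJump_le hη hψ hx v)

/-- The principal value that defines the specular diffusion operator exists. -/
lemma tendsto_integral_jump (hs0 : 0 < s) (hs1 : s < 1) (hη : IsReversibleMotion a r η)
    (hψ : IsRegular a r C ψ) (hm : Measurable ψ) {x : V} (hx : x ∈ Metric.ball a r) :
    Tendsto (fun ε => ∫ v in {v | ε < ‖v‖}, jump s η ψ x v) (𝓝[>] (0 : ℝ))
      (𝓝 (∫ v, evenJump s η ψ x v)) := by
  refine (tendsto_setIntegral_gt (integrable_evenJump hs0 hs1 hη hψ hm hx) measurable_norm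
    ae_norm_pos).congr' ?_
  filter_upwards [self_mem_nhdsWithin] with ε hε
  have h := integrableOn_jump hs0 hs1 hη hψ hm hx (Set.mem_Ioi.1 hε)
  -- The truncation is symmetric under v ↦ -v, so only the even part contributes.
  have hpre : (MeasurableEquiv.neg V) ⁻¹' {v : V | ε < ‖v‖} = {v : V | ε < ‖v‖} := by
    ext v; simp
  have hneg := (Measure.measurePreserving_neg (volume : Measure V))
  have e := hneg.setIntegral_preimage_emb (MeasurableEquiv.neg V).measurableEmbedding
    (fun v => jump s η ψ x v) {v | ε < ‖v‖}
  have i := (hneg.integrableOn_comp_preimage (MeasurableEquiv.neg V).measurableEmbedding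
    (f := fun v => jump s η ψ x v) (s := {v | ε < ‖v‖})).2 h
  change (∫ v in (MeasurableEquiv.neg V) ⁻¹' {v | ε < ‖v‖}, jump s η ψ x (-v)) = _ at e
  change IntegrableOn (fun v => jump s η ψ x (-v)) ((MeasurableEquiv.neg V) ⁻¹' {v | ε < ‖v‖}) at i
  rw [hpre] at e i
  simp only [evenJump]
  rw [integral_div, integral_add h i, e]
  ring

lemma integrable_mul_evenJump (hs0 : 0 < s) (hs1 : s < 1) (hr : 0 < r)
    (hη : IsReversibleMotion a r η) (hφ : IsRegular a r C φ) (hφm : Measurable φ)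
    (hψ : IsRegular a r C ψ) (hψm : Measurable ψ) :
    Integrable (fun q : V × V => φ q.1 * evenJump s η ψ q.1 q.2) (phaseVolume a r) := by
  have hm := measurable_evenJump (s := s) hη hψm
  refine ((((integrable_phaseVolume_snd (integrable_min_sq_div hs0 hs1) a r).add
    (integrable_shellWeight_prod hs0 hs1 a hr)).const_mul (2 * C)).const_mul C).mono'
    ((hφm.comp measurable_fst).mul hm).aestronglyMeasurable ?_
  filter_upwards [ae_phaseVolume_mem a r] with q hq
  rw [norm_mul]
  exact mul_le_mul (hφ.bound _ (Metric.ball_subset_closedBall hq)) (abs_evenJump_le hη hψ hq q.2)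
    (norm_nonneg _) hφ.nonneg

/-- The integrand of the bilinear form of the specular diffusion operator. -/
def energy (s : ℝ) (η : V → V → V) (φ ψ : V → ℝ) (q : V × V) : ℝ :=
  (φ q.1 - φ (η q.1 q.2)) * (ψ q.1 - ψ (η q.1 q.2)) / kernel V s ‖q.2‖

/-- A product of two first differences is already of size min 1 |v|², so no principal value is
needed. -/
lemma integrable_energy (hs0 : 0 < s) (hs1 : s < 1)
    (hη : IsReversibleMotion a r η) (hφ : IsRegular a r C φ) (hφm : Measurable φ)
    (hψ : IsRegular a r C ψ) (hψm : Measurable ψ) :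
    Integrable (energy s η φ ψ) (phaseVolume a r) := by
  have hm : Measurable (energy s η φ ψ) := by
    have := hη.measurable
    unfold energy; fun_prop
  refine (integrable_phaseVolume_snd ((integrable_min_sq_div hs0 hs1).const_mul
    (2 * C * (2 * C))) a r).mono' hm.aestronglyMeasurable ?_
  filter_upwards [ae_phaseVolume_mem a r] with q hq
  have hk : 0 ≤ kernel V s ‖q.2‖ := kernel_nonneg (norm_nonneg _)
  have hC := hφ.nonneg
  rw [energy, norm_div, norm_mul, Real.norm_of_nonneg hk, ← mul_div_assoc,
    ← min_one_sq (norm_nonneg _), mul_mul_mul_comm]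
  exact div_le_div_of_nonneg_right (mul_le_mul (abs_sub_eta_le hη hφ hq q.2)
    (abs_sub_eta_le hη hψ hq q.2) (norm_nonneg _) (by positivity)) hk

lemma integrableOn_mul_jump (hs0 : 0 < s) (hs1 : s < 1)
    (hη : IsReversibleMotion a r η) (hφ : IsRegular a r C φ) (hφm : Measurable φ)
    (hψ : IsRegular a r C ψ) (hψm : Measurable ψ) {ε : ℝ} (hε : 0 < ε) :
    IntegrableOn (fun q : V × V => φ q.1 * jump s η ψ q.1 q.2) {q | ε < ‖q.2‖}
      (phaseVolume a r) := by
  have hC := hψ.nonneg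
  have hm := measurable_jump (s := s) hη hψm
  refine ((integrable_phaseVolume_snd ((integrable_min_sq_div (V := V) hs0 hs1).const_mul
    (C * (2 * C * (min 1 (ε ^ 2))⁻¹))) a r).integrableOn).mono'
    ((hφm.comp measurable_fst).mul hm).aestronglyMeasurable ?_
  filter_upwards [ae_restrict_mem (measurableSet_lt measurable_const measurable_snd.norm),
    ae_restrict_of_ae (ae_phaseVolume_mem a r)] with q hq hx
  have hq : ε < ‖q.2‖ := hq
  have hk : 0 ≤ kernel V s ‖q.2‖ := kernel_nonneg (norm_nonneg _)
  rw [norm_mul, mul_assoc]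
  refine mul_le_mul (hφ.bound _ (Metric.ball_subset_closedBall hx)) ?_ (norm_nonneg _) hC
  rw [jump, norm_div, Real.norm_of_nonneg hk, ← mul_div_assoc, mul_assoc]
  refine div_le_div_of_nonneg_right ((abs_sub_eta_le hη hψ hx _).trans ?_) hk
  exact mul_le_mul_of_nonneg_left ((min_le_left _ _).trans (one_le_mul_min_sq hε hq.le))
    (by linarith)

lemma setIntegral_mul_evenJump (hs0 : 0 < s) (hs1 : s < 1)
    (hη : IsReversibleMotion a r η) (hφ : IsRegular a r C φ) (hφm : Measurable φ)
    (hψ : IsRegular a r C ψ) (hψm : Measurable ψ) {ε : ℝ} (hε : 0 < ε) :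
    ∫ q in {q : V × V | ε < ‖q.2‖}, φ q.1 * evenJump s η ψ q.1 q.2 ∂phaseVolume a r
      = ∫ q in {q : V × V | ε < ‖q.2‖}, φ q.1 * jump s η ψ q.1 q.2 ∂phaseVolume a r := by
  have h := integrableOn_mul_jump hs0 hs1 hη hφ hφm hψ hψm hε
  let e : V × V ≃ᵐ V × V := (MeasurableEquiv.refl V).prodCongr (MeasurableEquiv.neg V)
  have he : MeasurePreserving e (phaseVolume a r) (phaseVolume a r) := by
    rw [phaseVolume_eq]
    exact (MeasurePreserving.id _).prod (Measure.measurePreserving_neg (volume : Measure V))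
  have hpre : e ⁻¹' {q : V × V | ε < ‖q.2‖} = {q : V × V | ε < ‖q.2‖} := by
    ext q
    change ε < ‖-q.2‖ ↔ ε < ‖q.2‖
    rw [norm_neg]
  have h1 := he.setIntegral_preimage_emb e.measurableEmbedding
    (fun q => φ q.1 * jump s η ψ q.1 q.2) {q | ε < ‖q.2‖}
  have i := (he.integrableOn_comp_preimage e.measurableEmbedding).2 h
  change (∫ q in e ⁻¹' {q | ε < ‖q.2‖}, φ q.1 * jump s η ψ q.1 (-q.2) ∂phaseVolume a r) = _ at h1
  change IntegrableOn (fun q => φ q.1 * jump s η ψ q.1 (-q.2)) (e ⁻¹' {q | ε < ‖q.2‖}) _ at i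
  rw [hpre] at h1 i
  have e2 (q : V × V) : φ q.1 * evenJump s η ψ q.1 q.2
      = (φ q.1 * jump s η ψ q.1 q.2 + φ q.1 * jump s η ψ q.1 (-q.2)) / 2 := by
    rw [evenJump]; ring
  simp only [e2]
  rw [integral_div, integral_add h i, h1]
  ring

/-- Away from v = 0 the integral may be split. By `swap` it equals its copy with x and η exchanged,
and φ(x)(ψ(x) - ψ(η)) + φ(η)(ψ(η) - ψ(x)) is the numerator of the energy. -/
lemma setIntegral_mul_jump (hs0 : 0 < s) (hs1 : s < 1)
    (hη : IsReversibleMotion a r η) (hφ : IsRegular a r C φ) (hφm : Measurable φ)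
    (hψ : IsRegular a r C ψ) (hψm : Measurable ψ) {ε : ℝ} (hε : 0 < ε) :
    ∫ q in {q : V × V | ε < ‖q.2‖}, φ q.1 * jump s η ψ q.1 q.2 ∂phaseVolume a r
      = 1 / 2 * ∫ q in {q : V × V | ε < ‖q.2‖}, energy s η φ ψ q ∂phaseVolume a r := by
  have hS : MeasurableSet {q : V × V | ε < ‖q.2‖} :=
    measurableSet_lt measurable_const measurable_snd.norm
  have hT : MeasurableSet {z : V × V × ℝ | ε < z.2.2} :=
    measurableSet_lt measurable_const (by fun_prop)
  -- The truncation depends on |v| alone, so it belongs to the function of (x, η, |v|) that is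
  -- exchanged.
  let F : V × V × ℝ → ℝ := {z : V × V × ℝ | ε < z.2.2}.indicator
    fun z => φ z.1 * ((ψ z.1 - ψ z.2.1) / kernel V s z.2.2)
  have hF : Measurable F := Measurable.indicator (by fun_prop) hT
  have hηm := hη.measurable
  have h1 : Measurable fun q : V × V => (q.1, η q.1 q.2, ‖q.2‖) := by fun_prop
  have h2 : Measurable fun q : V × V => (η q.1 q.2, q.1, ‖q.2‖) := by fun_prop
  have f1 : (fun q : V × V => F (q.1, η q.1 q.2, ‖q.2‖)) = {q : V × V | ε < ‖q.2‖}.indicator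
      fun q => φ q.1 * jump s η ψ q.1 q.2 := rfl
  have f2 : (fun q : V × V => F (η q.1 q.2, q.1, ‖q.2‖)) = {q : V × V | ε < ‖q.2‖}.indicator
      fun q => φ (η q.1 q.2) * ((ψ (η q.1 q.2) - ψ q.1) / kernel V s ‖q.2‖) := rfl
  have hi1 := integrableOn_mul_jump hs0 hs1 hη hφ hφm hψ hψm hε
  have hi2 : IntegrableOn (fun q => φ (η q.1 q.2) * ((ψ (η q.1 q.2) - ψ q.1) / kernel V s ‖q.2‖))
      {q : V × V | ε < ‖q.2‖} (phaseVolume a r) := by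
    rw [← integrable_indicator_iff hS, ← f2]
    rw [← integrable_indicator_iff hS, ← f1] at hi1
    have h3 := (integrable_map_measure hF.aestronglyMeasurable h1.aemeasurable).2 hi1
    rw [hη.swap] at h3
    exact (integrable_map_measure hF.aestronglyMeasurable h2.aemeasurable).1 h3
  have hswap : ∫ q in {q : V × V | ε < ‖q.2‖}, φ q.1 * jump s η ψ q.1 q.2 ∂phaseVolume a r
      = ∫ q in {q : V × V | ε < ‖q.2‖}, φ (η q.1 q.2) * ((ψ (η q.1 q.2) - ψ q.1)
        / kernel V s ‖q.2‖) ∂phaseVolume a r := by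
    rw [← integral_indicator hS, ← integral_indicator hS, ← f1, ← f2,
      ← integral_map h1.aemeasurable hF.aestronglyMeasurable, hη.swap,
      integral_map h2.aemeasurable hF.aestronglyMeasurable]
  have hsum : ∫ q in {q : V × V | ε < ‖q.2‖}, energy s η φ ψ q ∂phaseVolume a r
      = ∫ q in {q : V × V | ε < ‖q.2‖}, φ q.1 * jump s η ψ q.1 q.2 ∂phaseVolume a r
        + ∫ q in {q : V × V | ε < ‖q.2‖}, φ (η q.1 q.2) * ((ψ (η q.1 q.2) - ψ q.1)
          / kernel V s ‖q.2‖) ∂phaseVolume a r := by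
    rw [← integral_add hi1 hi2]
    refine integral_congr_ae (Eventually.of_forall fun q => ?_)
    simp only [energy, jump]
    ring
  rw [hsum, ← hswap]
  ring

/-- The integration by parts formula, with the principal value written as an absolutely convergent
integral. -/
lemma integral_mul_evenJump (hs0 : 0 < s) (hs1 : s < 1) (hr : 0 < r)
    (hη : IsReversibleMotion a r η) (hφ : IsRegular a r C φ) (hφm : Measurable φ)
    (hψ : IsRegular a r C ψ) (hψm : Measurable ψ) :
    ∫ q, φ q.1 * evenJump s η ψ q.1 q.2 ∂phaseVolume a r
      = 1 / 2 * ∫ q, energy s η φ ψ q ∂phaseVolume a r := by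
  have h1 := tendsto_setIntegral_gt (integrable_mul_evenJump hs0 hs1 hr hη hφ hφm hψ hψm)
    measurable_snd.norm (ae_phaseVolume_norm_pos a r)
  have h2 := (tendsto_setIntegral_gt (integrable_energy hs0 hs1 hη hφ hφm hψ hψm)
    measurable_snd.norm (ae_phaseVolume_norm_pos a r)).const_mul (1 / 2)
  refine tendsto_nhds_unique h1 (h2.congr' ?_)
  filter_upwards [self_mem_nhdsWithin] with ε hε
  rw [setIntegral_mul_evenJump hs0 hs1 hη hφ hφm hψ hψm hε,
    setIntegral_mul_jump hs0 hs1 hη hφ hφm hψ hψm hε]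

end IntegrationByParts

end SpecularBall

end

/-! ### Application to specular reflection -/

noncomputable section

namespace SpecularBall

section Specular

variable {d : ℕ}

lemma isReversibleMotion_etaExt [NeZero d] (a : E d) {r : ℝ} (hr : 0 < r) :
    IsReversibleMotion a r (etaExt a r) where
  measurable := measurable_etaExt a r
  mem x hx v := by
    have h := eta_mem_closedBall hr a (mem_ball_iff_norm.1 hx) v
    rw [add_sub_cancel, eta_eq_endPoint hr a hx] at h
    exact mem_closedBall_iff_norm.2 h
  dist_le x hx v := by
    rw [norm_sub_rev, etaExt, ← eta_eq_endPoint hr a hx]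
    exact norm_eta_sub_le a r x v
  eq_add x hx v hv := by
    have h := eta_eq_add hr a (c := x - a) (v := v) (mem_ball_iff_norm.1 hx)
      (by rw [← add_sub_right_comm]; exact mem_ball_iff_norm.1 hv)
    rw [add_sub_cancel, eta_eq_endPoint hr a hx] at h
    exact h
  swap := map_etaExt_swap a hr

/-- Nothing is known about `ψ` outside the closed ball; cutting it off there gives a measurable
function with the same values along trajectories. -/
lemma measurable_indicator_closedBall {a : E d} {r : ℝ} {ψ : E d → ℝ}
    (hψ : ContDiffOn ℝ 2 ψ (Metric.closedBall a r)) :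
    Measurable ((Metric.closedBall a r).indicator ψ) := by
  classical
  rw [← Set.piecewise_eq_indicator]
  exact hψ.continuousOn.measurable_piecewise continuousOn_const measurableSet_closedBall

variable {a : E d} {r s : ℝ} {φ ψ : E d → ℝ}

lemma indicator_eta (hr : 0 < r) {x : E d} (hx : x ∈ Metric.ball a r) (v : E d) :
    (Metric.closedBall a r).indicator ψ (etaExt a r x v) = ψ (eta a r x v) := by
  have h := eta_mem_closedBall hr a (mem_ball_iff_norm.1 hx) v
  rw [add_sub_cancel] at h
  rw [etaExt, ← eta_eq_endPoint hr a hx, Set.indicator_of_mem (mem_closedBall_iff_norm.2 h)]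

lemma kernel_eq (s t : ℝ) : kernel (E d) s t = t ^ ((d : ℝ) + 2 * s) := by
  rw [kernel, finrank_euclideanSpace_fin]

lemma jump_indicator (hr : 0 < r) {x : E d} (hx : x ∈ Metric.ball a r) (v : E d) :
    jump s (etaExt a r) ((Metric.closedBall a r).indicator ψ) x v
      = (ψ x - ψ (eta a r x v)) / ‖v‖ ^ ((d : ℝ) + 2 * s) := by
  rw [jump, kernel_eq, indicator_eta hr hx,
    Set.indicator_of_mem (Metric.ball_subset_closedBall hx)]

lemma energy_indicator (hr : 0 < r) {q : E d × E d} (hq : q.1 ∈ Metric.ball a r) :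
    energy s (etaExt a r) ((Metric.closedBall a r).indicator φ)
        ((Metric.closedBall a r).indicator ψ) q
      = (φ q.1 - φ (eta a r q.1 q.2)) * (ψ q.1 - ψ (eta a r q.1 q.2))
        / ‖q.2‖ ^ ((d : ℝ) + 2 * s) := by
  rw [energy, kernel_eq, indicator_eta hr hq, indicator_eta hr hq,
    Set.indicator_of_mem (Metric.ball_subset_closedBall hq),
    Set.indicator_of_mem (Metric.ball_subset_closedBall hq)]

lemma exists_isRegular_indicator (hr : 0 < r) (hφ : ContDiffOn ℝ 2 φ (Metric.closedBall a r))
    (hψ : ContDiffOn ℝ 2 ψ (Metric.closedBall a r)) :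
    ∃ C, IsRegular a r C ((Metric.closedBall a r).indicator φ) ∧
      IsRegular a r C ((Metric.closedBall a r).indicator ψ) := by
  obtain ⟨C, hC⟩ := exists_isRegular hr
    (hφ.congr fun x hx => Set.indicator_of_mem hx φ)
  obtain ⟨C', hC'⟩ := exists_isRegular hr
    (hψ.congr fun x hx => Set.indicator_of_mem hx ψ)
  exact ⟨max C C', hC.mono (le_max_left _ _), hC'.mono (le_max_right _ _)⟩

variable [NeZero d]

lemma tendsto_truncInt (hs0 : 0 < s) (hs1 : s < 1) (hr : 0 < r)
    (hψ : ContDiffOn ℝ 2 ψ (Metric.closedBall a r)) {x : E d} (hx : x ∈ Metric.ball a r) :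
    Tendsto (truncInt a r s ψ x) (𝓝[>] (0 : ℝ))
      (𝓝 (∫ v, evenJump s (etaExt a r) ((Metric.closedBall a r).indicator ψ) x v)) := by
  obtain ⟨C, hC, -⟩ := exists_isRegular_indicator hr hψ hψ
  have h := tendsto_integral_jump hs0 hs1 (isReversibleMotion_etaExt a hr) hC
    (measurable_indicator_closedBall hψ) hx
  simp only [jump_indicator hr hx] at h
  exact h

lemma specularDiffusion_eq (hs0 : 0 < s) (hs1 : s < 1) (hr : 0 < r)
    (hψ : ContDiffOn ℝ 2 ψ (Metric.closedBall a r)) {x : E d} (hx : x ∈ Metric.ball a r) :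
    specularDiffusion a r s ψ x = fracConst d s *
      ∫ v, evenJump s (etaExt a r) ((Metric.closedBall a r).indicator ψ) x v := by
  rw [specularDiffusion, (tendsto_truncInt hs0 hs1 hr hψ hx).limUnder_eq]

lemma mul_specularDiffusion_eq (hs0 : 0 < s) (hs1 : s < 1) (hr : 0 < r)
    (hψ : ContDiffOn ℝ 2 ψ (Metric.closedBall a r)) {x : E d} (hx : x ∈ Metric.ball a r) :
    φ x * specularDiffusion a r s ψ x = fracConst d s *
      ∫ v, (Metric.closedBall a r).indicator φ x *
        evenJump s (etaExt a r) ((Metric.closedBall a r).indicator ψ) x v := by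
  rw [specularDiffusion_eq hs0 hs1 hr hψ hx, integral_const_mul,
    Set.indicator_of_mem (Metric.ball_subset_closedBall hx)]
  ring

lemma integrableOn_mul_specularDiffusion (hs0 : 0 < s) (hs1 : s < 1) (hr : 0 < r)
    (hφ : ContDiffOn ℝ 2 φ (Metric.closedBall a r))
    (hψ : ContDiffOn ℝ 2 ψ (Metric.closedBall a r)) :
    IntegrableOn (fun x => φ x * specularDiffusion a r s ψ x) (Metric.ball a r) := by
  obtain ⟨C, hC, hC'⟩ := exists_isRegular_indicator hr hφ hψ
  have h := integrable_mul_evenJump hs0 hs1 hr (isReversibleMotion_etaExt a hr) hC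
    (measurable_indicator_closedBall hφ) hC' (measurable_indicator_closedBall hψ)
  rw [phaseVolume_eq] at h
  exact IntegrableOn.congr_fun (h.integral_prod_left.const_mul (fracConst d s))
    (fun x hx => (mul_specularDiffusion_eq hs0 hs1 hr hψ hx).symm) measurableSet_ball

lemma integrableOn_energy (hs0 : 0 < s) (hs1 : s < 1) (hr : 0 < r)
    (hφ : ContDiffOn ℝ 2 φ (Metric.closedBall a r))
    (hψ : ContDiffOn ℝ 2 ψ (Metric.closedBall a r)) :
    IntegrableOn (fun p : E d × E d =>
        (φ p.1 - φ (eta a r p.1 p.2)) * (ψ p.1 - ψ (eta a r p.1 p.2))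
          / ‖p.2‖ ^ ((d : ℝ) + 2 * s)) (Metric.ball a r ×ˢ Set.univ) := by
  obtain ⟨C, hC, hC'⟩ := exists_isRegular_indicator hr hφ hψ
  exact IntegrableOn.congr_fun (integrable_energy hs0 hs1 (isReversibleMotion_etaExt a hr) hC
    (measurable_indicator_closedBall hφ) hC' (measurable_indicator_closedBall hψ))
    (fun q hq => energy_indicator hr hq.1) (measurableSet_ball.prod MeasurableSet.univ)

/-- Pointwise the principal value is the integral of `evenJump`, so Fubini turns the left side into
the phase space integral of `integral_mul_evenJump`. -/
lemma integral_mul_specularDiffusion (hs0 : 0 < s) (hs1 : s < 1) (hr : 0 < r)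
    (hφ : ContDiffOn ℝ 2 φ (Metric.closedBall a r))
    (hψ : ContDiffOn ℝ 2 ψ (Metric.closedBall a r)) :
    ∫ x in Metric.ball a r, φ x * specularDiffusion a r s ψ x = fracConst d s / 2 *
      ∫ p in (Metric.ball a r ×ˢ Set.univ : Set (E d × E d)),
        (φ p.1 - φ (eta a r p.1 p.2)) * (ψ p.1 - ψ (eta a r p.1 p.2))
          / ‖p.2‖ ^ ((d : ℝ) + 2 * s) := by
  obtain ⟨C, hC, hC'⟩ := exists_isRegular_indicator hr hφ hψ
  have hη := isReversibleMotion_etaExt a hr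
  have hφm := measurable_indicator_closedBall hφ
  have hψm := measurable_indicator_closedBall hψ
  have hi := integrable_mul_evenJump hs0 hs1 hr hη hC hφm hC' hψm
  have h := integral_mul_evenJump hs0 hs1 hr hη hC hφm hC' hψm
  rw [phaseVolume_eq] at hi
  rw [setIntegral_congr_fun measurableSet_ball fun x hx =>
      mul_specularDiffusion_eq hs0 hs1 hr hψ hx, integral_const_mul,
    ← setIntegral_congr_fun (measurableSet_ball.prod MeasurableSet.univ) fun q hq =>
      energy_indicator hr hq.1, ← integral_prod _ hi, ← phaseVolume_eq, h, phaseVolume]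
  ring

end Specular

end SpecularBall
end

theorem mainTheorem9 (d : ℕ) [NeZero d] (s : ℝ) (hs0 : 0 < s) (hs1 : s < 1)
    (a : EuclideanSpace ℝ (Fin d)) (r : ℝ) (hr : 0 < r)
    (φ ψ : EuclideanSpace ℝ (Fin d) → ℝ)
    (hφ : ContDiffOn ℝ 2 φ (Metric.closedBall a r))
    (hψ : ContDiffOn ℝ 2 ψ (Metric.closedBall a r)) :
    -- the principal value that defines the operator exists at every point of the ball
    (∀ x ∈ Metric.ball a r,
      (∀ ε : ℝ, 0 < ε → IntegrableOn
        (fun w : EuclideanSpace ℝ (Fin d) =>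
          (ψ x - ψ (SpecularBall.eta a r x w)) / ‖w‖ ^ ((d : ℝ) + 2 * s))
        {w | ε < ‖w‖}) ∧
      ∃ l : ℝ, Tendsto (SpecularBall.truncInt a r s ψ x) (𝓝[>] (0 : ℝ)) (𝓝 l)) ∧
    -- both sides of the formula are absolutely convergent integrals
    IntegrableOn (fun x => φ x * SpecularBall.specularDiffusion a r s ψ x) (Metric.ball a r) ∧
    IntegrableOn
      (fun p : EuclideanSpace ℝ (Fin d) × EuclideanSpace ℝ (Fin d) =>
        (φ p.1 - φ (SpecularBall.eta a r p.1 p.2)) * (ψ p.1 - ψ (SpecularBall.eta a r p.1 p.2))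
          / ‖p.2‖ ^ ((d : ℝ) + 2 * s))
      (Metric.ball a r ×ˢ Set.univ) ∧
    -- integration by parts
    ∫ x in Metric.ball a r, φ x * SpecularBall.specularDiffusion a r s ψ x =
      SpecularBall.fracConst d s / 2 *
        ∫ p in (Metric.ball a r ×ˢ Set.univ :
            Set (EuclideanSpace ℝ (Fin d) × EuclideanSpace ℝ (Fin d))),
          (φ p.1 - φ (SpecularBall.eta a r p.1 p.2)) * (ψ p.1 - ψ (SpecularBall.eta a r p.1 p.2))
            / ‖p.2‖ ^ ((d : ℝ) + 2 * s) ∧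
    -- symmetry
    ∫ x in Metric.ball a r, φ x * SpecularBall.specularDiffusion a r s ψ x =
      ∫ x in Metric.ball a r, ψ x * SpecularBall.specularDiffusion a r s φ x := by
  refine ⟨fun x hx => ⟨fun ε hε => ?_, _, SpecularBall.tendsto_truncInt hs0 hs1 hr hψ hx⟩,
    SpecularBall.integrableOn_mul_specularDiffusion hs0 hs1 hr hφ hψ,
    SpecularBall.integrableOn_energy hs0 hs1 hr hφ hψ,
    SpecularBall.integral_mul_specularDiffusion hs0 hs1 hr hφ hψ, ?_⟩
  · obtain ⟨C, hC, -⟩ := SpecularBall.exists_isRegular_indicator hr hψ hψ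
    have h := SpecularBall.integrableOn_jump hs0 hs1
      (SpecularBall.isReversibleMotion_etaExt a hr) hC
      (SpecularBall.measurable_indicator_closedBall hψ) hx hε
    simp only [SpecularBall.jump_indicator hr hx] at h
    exact h
  · rw [SpecularBall.integral_mul_specularDiffusion hs0 hs1 hr hφ hψ,
      SpecularBall.integral_mul_specularDiffusion hs0 hs1 hr hψ hφ]
    -- The energy form is symmetric in `φ` and `ψ`.
    simp only [mul_comm]
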